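/- For $n\ge 1$ let $a_{i,j}, b_{i,k}, c_{j,k}$ ($1\le i,j,k\le n$) be independent random variables, uniform on $[0,1]$, and let $W_{i,j,k}=a_{i,j}+b_{i,k}+c_{j,k}$. Let $Z_n=\min\sum_{i=1}^n W_{i,\sigma(i),\tau(i)}$, the minimum being over all pairs of permutations $\sigma,\tau$ of $[n]$. The algorithm Greedy($m$) starts with $B=C=[n]$ and, for $i=1,\dots,m$ in turn, chooses $(j,k)\in B\times C$ that minimizes $W_{i,j,k}$, adds the triple $(i,j,k)$ to the assignment, and removes $j$ from $B$ and $k$ from $C$; the partial assignment obtained is finally completed in an arbitrary way (which may depend on all the costs) to a pair of permutations $(\sigma,\tau)$, of cost $\sum_{i=1}^n W_{i,\sigma(i),\tau(i)}$. There are constants $c_1,c_2>0$, not depending on $n$, such that for all $n\ge 1$: (a) $\mathbf{E}(Z_n)\ge c_1 n^{1/3}$; (b) for $m=\lfloor n-n^{1/4}\rfloor$, the assignment produced by Greedy($m$), however it is completed, has expected cost at most $c_2n^{1/3}$. Moreover greedy is asymptotically a $3$-approximation in expectation: for every $\varepsilon>0$ there is an $N$ such that for all $n\ge N$ the expected cost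 of the assignment produced by Greedy($\lfloor n-n^{1/4}\rfloor$), however it is completed, is at most $(3+\varepsilon)\,\mathbf{E}(Z_n)$. -/

import Mathlib

universe u

open MeasureTheory ProbabilityTheory

noncomputable section

/-- The decomposable cost `W i j k = a i j + b i k + c j k` of a triple `(i, j, k)`. -/
def tripleCost {n : ℕ} (a b c : Fin n → Fin n → ℝ) (i j k : Fin n) : ℝ :=
  a i j + b i k + c j k

/-- The cost `∑ i, W i (σ i) (τ i)` of the assignment given by two permutations. -/
def assignmentCost {n : ℕ} (W : Fin n → Fin n → Fin n → ℝ) (σ τ : Equiv.Perm (Fin n)) : ℝ :=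
  ∑ i, W i (σ i) (τ i)

/-- The minimum cost of an assignment, over all pairs of permutations. -/
def optimalCost {n : ℕ} (W : Fin n → Fin n → Fin n → ℝ) : ℝ :=
  Finset.univ.inf' Finset.univ_nonempty
    fun p : Equiv.Perm (Fin n) × Equiv.Perm (Fin n) => assignmentCost W p.1 p.2

/-- `GreedyRun W m B C T`: after `m` rounds of the greedy algorithm, `B` and `C` may be the sets
of second and third indices not used so far, and `T` the set of triples chosen so far. The round
that follows `t` rounds treats the first index `t` (indices are counted from `0`); it chooses a
pair `(j, k)` in `B × C` of minimum cost. Ties may be broken in any way. -/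
inductive GreedyRun {n : ℕ} (W : Fin n → Fin n → Fin n → ℝ) :
    ℕ → Finset (Fin n) → Finset (Fin n) → Finset (Fin n × Fin n × Fin n) → Prop
  | init : GreedyRun W 0 Finset.univ Finset.univ ∅
  | step {B C : Finset (Fin n)} {T : Finset (Fin n × Fin n × Fin n)} (i j k : Fin n)
      (run : GreedyRun W i B C T) (hj : j ∈ B) (hk : k ∈ C)
      (hmin : ∀ j' ∈ B, ∀ k' ∈ C, W i j k ≤ W i j' k') :
      GreedyRun W (i + 1) (B.erase j) (C.erase k) (insert (i, j, k) T)

/-- The assignment `(σ, τ)` is a possible result of the greedy algorithm with `m` rounds: it is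
an arbitrary completion of a partial assignment that the `m` rounds may return. -/
def IsGreedySolution {n : ℕ} (W : Fin n → Fin n → Fin n → ℝ) (m : ℕ)
    (σ τ : Equiv.Perm (Fin n)) : Prop :=
  ∃ B C T, GreedyRun W m B C T ∧ ∀ i j k, (i, j, k) ∈ T → σ i = j ∧ τ i = k

/-- The number `n - n^{1/4}` of greedy rounds, rounded down. -/
def greedyRounds (n : ℕ) : ℕ := ⌊(n : ℝ) - (n : ℝ) ^ (1 / 4 : ℝ)⌋₊

/-- The three arrays `a`, `b`, `c` of random variables as one family. -/
def costFamily {Ω : Type u} {n : ℕ} (a b c : Fin n → Fin n → Ω → ℝ) :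
    (Fin n × Fin n) ⊕ (Fin n × Fin n) ⊕ (Fin n × Fin n) → Ω → ℝ :=
  Sum.elim (fun p => a p.1 p.2) (Sum.elim (fun p => b p.1 p.2) (fun p => c p.1 p.2))

/-- All the entries of `a`, `b`, `c` are independent random variables, each uniform on `[0, 1]`. -/
structure IsUniformModel {Ω : Type u} [MeasurableSpace Ω] (μ : Measure Ω) {n : ℕ}
    (a b c : Fin n → Fin n → Ω → ℝ) : Prop where
  measurable : ∀ s, Measurable (costFamily a b c s)
  indep : iIndepFun (costFamily a b c) μ
  uniform : ∀ s, pdf.IsUniform (costFamily a b c s) (Set.Icc (0 : ℝ) 1) μ volume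

/-- The random costs `W i j k` of the model, at the sample point `ω`. -/
def randomCost {Ω : Type u} {n : ℕ} (a b c : Fin n → Fin n → Ω → ℝ) (ω : Ω) :
    Fin n → Fin n → Fin n → ℝ :=
  tripleCost (fun i j => a i j ω) (fun i k => b i k ω) (fun j k => c j k ω)

/-- `(σ, τ)` is a random assignment that is almost surely a result of the greedy algorithm with
`m` rounds. How it is completed (and how ties are broken) may depend on all the costs and on any
further randomness in `Ω`. -/
structure IsRandomGreedySolution {Ω : Type u} [MeasurableSpace Ω] (μ : Measure Ω) {n : ℕ}
    (a b c : Fin n → Fin n → Ω → ℝ) (m : ℕ) (σ τ : Ω → Equiv.Perm (Fin n)) : Prop where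
  measurable_left : ∀ p, MeasurableSet (σ ⁻¹' {p})
  measurable_right : ∀ p, MeasurableSet (τ ⁻¹' {p})
  greedy : ∀ᵐ ω ∂μ, IsGreedySolution (randomCost a b c ω) m (σ ω) (τ ω)

end

/-!
# The greedy algorithm for random axial three-dimensional assignment with decomposable costs

Both sides are governed by the minimum of `a_j + b_k + c_{jk}` over an `m × m` rectangle `B × C`.
The expected number of pairs of cost less than `x` is `m ^ 2 * x ^ 3 / 6`, and these pairs are
nearly Poisson, so the minimum exceeds `u * m ^ (-2/3)` with probability about
`exp (-u ^ 3 / 6)` and has mean about `κ * m ^ (-2/3)` with `κ = ∫ exp (-u ^ 3 / 6)`. The optimum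
is at least the sum of `n` row minima, about `n * κ * n ^ (-2/3) = κ * n ^ (1/3)`, whereas greedy
pays about `∑ m ≤ n, κ * m ^ (-2/3) ≤ 3 * κ * n ^ (1/3)`. In place of `κ` the proof uses the
truncation `tailIntegral U`, the same on both sides, and lets `U` be large.

The lower bound for a row minimum (`le_integral_avoidProb`) is Jensen's inequality. The difficulty
of the upper bound is that the sets `B`, `C` that greedy meets in a round depend on the costs `c`;
they are independent of the costs `a`, `b` of the current row. So consider the probability
`avoidProb`, over this row only, that all triples in `B × C` cost at least `x`. It is a function
of the costs `c`. Its mean is close to the Poisson value by a second-moment computation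
(`integral_avoidProb_le`). A single cost `c_{jk}` changes it by at most `x ^ 2`, and only while it
is below `x`; a Bernstein-type inequality for functions of independent variables
(`measure_lt_le_of_bounded_differences`) then bounds the probability of a deviation by
`exp (-const * m ^ (4/3))`. This is smaller than the reciprocal of the number of pairs `B`, `C`,
at most `n ^ (2 * m)`, as soon as `m` is at least a fixed power of `n`. Hence with high probability
all rectangles are good at once (`measure_exceptional_le_inv_sq`), whichever one greedy meets.

For large `u` the tail of a round is controlled by cutting `B × C` into disjoint blocks, in which
the row costs are independent (`avoidProb_le_pow`, `measure_roundGe_tail`). The last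
`n ^ (1/4)` triples, over which greedy has no control, cost at most `3` each.
-/

noncomputable section

/-! ### Product measures -/

section ProductMeasure

variable {ι : Type*} [Fintype ι] [DecidableEq ι] {ν : Measure ℝ} [IsProbabilityMeasure ν]

/-- Resampling the coordinates in `S` from an independent copy preserves a product measure. -/
theorem measurePreserving_piecewise (ν : Measure ℝ) [IsProbabilityMeasure ν] (S : Finset ι) :
    MeasurePreserving (fun p : (ι → ℝ) × (ι → ℝ) => S.piecewise p.2 p.1)
      ((Measure.pi fun _ : ι => ν).prod (Measure.pi fun _ : ι => ν))
      (Measure.pi fun _ : ι => ν) := by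
  have hm : Measurable (fun p : (ι → ℝ) × (ι → ℝ) => S.piecewise p.2 p.1) := by
    refine measurable_pi_iff.2 fun i => ?_
    by_cases hi : i ∈ S
    · simp only [Finset.piecewise, hi, if_true]; fun_prop
    · simp only [Finset.piecewise, hi, if_false]; fun_prop
  refine ⟨hm, ?_⟩
  symm
  refine Measure.pi_eq fun s hs => ?_
  rw [Measure.map_apply hm (MeasurableSet.univ_pi hs)]
  have : (fun p : (ι → ℝ) × (ι → ℝ) => S.piecewise p.2 p.1) ⁻¹' (Set.univ.pi s) =
      (Set.univ.pi fun i => if i ∈ S then Set.univ else s i) ×ˢ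
      (Set.univ.pi fun i => if i ∈ S then s i else Set.univ) := by
    ext ⟨v, w⟩
    simp only [Set.mem_preimage, Set.mem_pi, Set.mem_univ, true_implies, Set.mem_prod,
      Finset.piecewise]
    rw [← forall_and]
    refine forall_congr' fun i => ?_
    by_cases hi : i ∈ S <;> simp [hi]
  rw [this, Measure.prod_prod, Measure.pi_pi, Measure.pi_pi, ← Finset.prod_mul_distrib]
  refine Finset.prod_congr rfl fun i _ => ?_
  by_cases hi : i ∈ S <;> simp [hi]

/-- Functions of disjoint sets of coordinates are uncorrelated under a product measure. -/
theorem integral_mul_eq_of_piecewise (S : Finset ι) {f g : (ι → ℝ) → ℝ}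
    (hf : Measurable f) (hg : Measurable g)
    (hfS : ∀ v w, f (S.piecewise w v) = f v) (hgS : ∀ v w, g (S.piecewise w v) = g w) :
    ∫ v, f v * g v ∂(Measure.pi fun _ : ι => ν) =
      (∫ v, f v ∂(Measure.pi fun _ : ι => ν)) * ∫ v, g v ∂(Measure.pi fun _ : ι => ν) := by
  have h := measurePreserving_piecewise ν S
  rw [← h.map_eq, integral_map h.measurable.aemeasurable (by fun_prop), h.map_eq,
    ← integral_prod_mul]
  simp only [hfS, hgS]

theorem pi_real_forall_mem (T : Finset ι) (A : ι → Set ℝ) :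
    (Measure.pi fun _ : ι => ν).real {v | ∀ s ∈ T, v s ∈ A s} = ∏ s ∈ T, ν.real (A s) := by
  have : {v : ι → ℝ | ∀ s ∈ T, v s ∈ A s} =
      Set.univ.pi fun i => if i ∈ T then A i else Set.univ := by
    ext v
    simp only [Set.mem_ofPred_eq, Set.mem_pi, Set.mem_univ, true_implies]
    refine forall_congr' fun i => ?_
    by_cases hi : i ∈ T <;> simp [hi]
  rw [this, Measure.real, Measure.pi_pi, ENNReal.toReal_prod]
  have h2 : ∀ i, (ν (if i ∈ T then A i else Set.univ)).toReal =
      if i ∈ T then ν.real (A i) else 1 := by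
    intro i; by_cases hi : i ∈ T <;> simp [hi, Measure.real]
  simp only [h2]
  rw [Finset.prod_ite_mem, Finset.univ_inter]

/-- One coordinate of the exponential moment bound: the variance of `g` is at most `M ^ 2 * p`,
because `g` is constant outside a set of measure at most `p`. -/
theorem integral_exp_le_of_const {g : ℝ → ℝ} (hg : Measurable g) {M x p l : ℝ}
    (hosc : ∀ t t', |g t - g t'| ≤ M) (hconst : ∀ t, x ≤ t → g t = g x)
    (hp : ν.real (Set.Iio x) ≤ p) (hl : 0 ≤ l) (hlM : l * M ≤ 1) :
    ∫ t, Real.exp (l * g t) ∂ν ≤ Real.exp (l * ∫ t, g t ∂ν + l ^ 2 * M ^ 2 * p) := by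
  have hM : 0 ≤ M := (abs_nonneg _).trans (hosc 0 0)
  have hbound : ∀ t, |g t| ≤ |g x| + M := fun t => by
    have h1 := hosc t x
    have h2 := abs_sub_abs_le_abs_sub (g t) (g x)
    linarith
  have hint : Integrable g ν :=
    Integrable.of_bound hg.aestronglyMeasurable (|g x| + M) (ae_of_all _ hbound)
  set e := ∫ t, g t ∂ν with he
  have hdev : ∀ t, |g t - e| ≤ M := by
    intro t
    have h1 : g t - e = ∫ t', (g t - g t') ∂ν := by
      rw [integral_sub (integrable_const _) hint]; simp [he]
    rw [h1, ← Real.norm_eq_abs]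
    refine (norm_integral_le_of_norm_le_const (C := M) (ae_of_all _ fun t' => hosc t t')).trans ?_
    simp
  have hsq : Integrable (fun t => (g t - e) ^ 2) ν := by
    refine Integrable.of_bound (by fun_prop) (M ^ 2) (ae_of_all _ fun t => ?_)
    rw [Real.norm_eq_abs, abs_pow]
    exact pow_le_pow_left₀ (abs_nonneg _) (hdev t) 2
  have hvar : ∫ t, (g t - e) ^ 2 ∂ν ≤ M ^ 2 * p := by
    have h1 : ∫ t, (g t - e) ^ 2 ∂ν ≤ ∫ t, (g t - g x) ^ 2 ∂ν := by
      have h2 : ∀ t, (g t - g x) ^ 2 = (g t - e) ^ 2 + ((2 * (e - g x)) * (g t - e)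
          + (e - g x) ^ 2) := fun t => by ring
      simp only [h2]
      have h3 : Integrable (fun t => g t - e) ν := hint.sub (integrable_const _)
      have h4 : Integrable (fun t => (2 * (e - g x)) * (g t - e) + (e - g x) ^ 2) ν :=
        (h3.const_mul _).add (integrable_const _)
      rw [integral_add hsq h4, integral_add (h3.const_mul _) (integrable_const _), integral_const_mul,
        integral_sub hint (integrable_const _)]
      simp [← he]
      positivity
    refine h1.trans ?_
    calc ∫ t, (g t - g x) ^ 2 ∂ν ≤ ∫ t, (Set.Iio x).indicator (fun _ => M ^ 2) t ∂ν := by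
          refine integral_mono_of_nonneg (ae_of_all _ fun t => sq_nonneg _)
            ((integrable_const _).indicator measurableSet_Iio) (ae_of_all _ fun t => ?_)
          by_cases ht : t < x
          · simp only [Set.indicator, Set.mem_Iio, ht, if_true]
            rw [← sq_abs]
            exact pow_le_pow_left₀ (abs_nonneg _) (hosc t x) 2
          · simp [Set.indicator, ht, hconst t (not_lt.1 ht)]
      _ = M ^ 2 * ν.real (Set.Iio x) := by
          rw [integral_indicator measurableSet_Iio, setIntegral_const]
          simp [mul_comm]
      _ ≤ M ^ 2 * p := by gcongr
  have hpt : ∀ t, Real.exp (l * g t) ≤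
      Real.exp (l * e) * (1 + (l * (g t - e) + l ^ 2 * (g t - e) ^ 2)) := by
    intro t
    have h1 : |l * (g t - e)| ≤ 1 := by
      rw [abs_mul, abs_of_nonneg hl]
      exact (mul_le_mul_of_nonneg_left (hdev t) hl).trans hlM
    have h2 := (abs_le.1 (Real.abs_exp_sub_one_sub_id_le h1)).2
    rw [show l * g t = l * e + l * (g t - e) by ring, Real.exp_add]
    gcongr
    nlinarith
  have h3 : Integrable (fun t => g t - e) ν := hint.sub (integrable_const _)
  have h4 : Integrable (fun t => l * (g t - e) + l ^ 2 * (g t - e) ^ 2) ν :=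
    (h3.const_mul _).add (hsq.const_mul _)
  calc ∫ t, Real.exp (l * g t) ∂ν
      ≤ ∫ t, Real.exp (l * e) * (1 + (l * (g t - e) + l ^ 2 * (g t - e) ^ 2)) ∂ν :=
        integral_mono_of_nonneg (ae_of_all _ fun t => (Real.exp_pos _).le)
          (((integrable_const _).add h4).const_mul _)
          (ae_of_all _ hpt)
    _ = Real.exp (l * e) * (1 + l ^ 2 * ∫ t, (g t - e) ^ 2 ∂ν) := by
        rw [integral_const_mul, integral_add (integrable_const _) h4, integral_add (h3.const_mul _)
          (hsq.const_mul _), integral_const_mul, integral_const_mul,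
          integral_sub hint (integrable_const _)]
        simp [← he]
    _ ≤ Real.exp (l * e) * Real.exp (l ^ 2 * M ^ 2 * p) := by
        gcongr
        have := Real.add_one_le_exp (l ^ 2 * M ^ 2 * p)
        nlinarith [mul_le_mul_of_nonneg_left hvar (sq_nonneg l)]
    _ = _ := by rw [← Real.exp_add]

/-- An exponential moment bound of Bernstein type. Each of the coordinates in `S` moves `F` by at
most `M`, and only while it is below `x`, which has probability at most `p`; so the martingale
that reveals the coordinates one at a time has total variance at most `S.card * M ^ 2 * p`. -/
theorem integral_exp_le_of_bounded_differences (S : Finset ι) {M x p l K : ℝ}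
    (hp : ν.real (Set.Iio x) ≤ p) (hl : 0 ≤ l) (hlM : l * M ≤ 1)
    (F : (ι → ℝ) → ℝ) (hF : Measurable F) (hb : ∀ v, |F v| ≤ K)
    (hdep : ∀ v w, (∀ s ∈ S, v s = w s) → F v = F w)
    (hosc : ∀ v s t t', |F (Function.update v s t) - F (Function.update v s t')| ≤ M)
    (hconst : ∀ v s t, x ≤ t → F (Function.update v s t) = F (Function.update v s x)) :
    ∫ v, Real.exp (l * F v) ∂(Measure.pi fun _ : ι => ν) ≤
      Real.exp (l * ∫ v, F v ∂(Measure.pi fun _ : ι => ν) + S.card * (l ^ 2 * M ^ 2 * p)) := by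
  induction S using Finset.induction_on generalizing F with
  | empty =>
    have h : ∀ v, F v = F 0 := fun v => hdep v 0 (by simp)
    simp only [fun v => h v]
    simp
  | insert s S hs ih =>
    have hm2 : Measurable (fun q : (ι → ℝ) × ℝ => F (Function.update q.1 s q.2)) := by
      refine hF.comp (measurable_pi_iff.2 fun i => ?_)
      by_cases hi : i = s
      · subst hi; simp; fun_prop
      · simp [Function.update_of_ne hi]; fun_prop
    have hinner : ∀ v, Integrable (fun t => F (Function.update v s t)) ν := fun v =>
      Integrable.of_bound (hm2.comp (measurable_const.prodMk measurable_id)).aestronglyMeasurable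
        K (ae_of_all _ fun t => hb _)
    set F' : (ι → ℝ) → ℝ := fun v => ∫ t, F (Function.update v s t) ∂ν with hF'
    -- Fubini in the single coordinate `s`
    have hfub : ∀ G : (ι → ℝ) → ℝ, Measurable G → (∃ K', ∀ v, |G v| ≤ K') →
        ∫ v, G v ∂(Measure.pi fun _ : ι => ν) =
          ∫ v, ∫ t, G (Function.update v s t) ∂ν ∂(Measure.pi fun _ : ι => ν) := by
      rintro G hG ⟨K', hK'⟩
      have h := measurePreserving_piecewise ν ({s} : Finset ι)
      have hGi : Integrable (fun q : (ι → ℝ) × (ι → ℝ) => G (({s} : Finset ι).piecewise q.2 q.1))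
          ((Measure.pi fun _ : ι => ν).prod (Measure.pi fun _ : ι => ν)) :=
        Integrable.of_bound (hG.comp h.measurable).aestronglyMeasurable K'
          (ae_of_all _ fun q => hK' _)
      rw [← h.map_eq, integral_map h.measurable.aemeasurable hG.aestronglyMeasurable, h.map_eq,
        integral_prod _ hGi]
      refine integral_congr_ae (ae_of_all _ fun v => ?_)
      have hm3 : Measurable (fun t : ℝ => G (Function.update v s t)) :=
        hG.comp (measurable_update v)
      have he := measurePreserving_eval (fun _ : ι => ν) s
      simp only
      conv_rhs => rw [← he.map_eq]
      rw [integral_map he.measurable.aemeasurable hm3.aestronglyMeasurable]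
      simp [Finset.piecewise_singleton]
    have hF'm : Measurable F' := hm2.stronglyMeasurable.integral_prod_right.measurable
    have hcomm : ∀ (v : ι → ℝ) (r : ι) (t t₁ : ℝ), r ≠ s →
        Function.update (Function.update v r t) s t₁ = Function.update (Function.update v s t₁) r t := fun v r t t₁ h =>
      Function.update_comm h _ _ _
    have hF's : ∀ (v : ι → ℝ) (t : ℝ), F' (Function.update v s t) = F' v := fun v t => by simp [hF']
    have hM : 0 ≤ M := (abs_nonneg _).trans (hosc 0 s 0 0)
    have hIF : ∫ v, F v ∂(Measure.pi fun _ : ι => ν) = ∫ v, F' v ∂(Measure.pi fun _ : ι => ν) :=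
      hfub F hF ⟨K, hb⟩
    have hF'b : ∀ v, |F' v| ≤ K := fun v => by
      rw [← Real.norm_eq_abs]
      refine (norm_integral_le_of_norm_le_const (C := K) (ae_of_all _ fun t => hb _)).trans ?_
      simp
    have hih := ih F' hF'm hF'b
      (fun v w hvw => by
        refine integral_congr_ae (ae_of_all _ fun t => hdep _ _ fun r hr => ?_)
        by_cases hrs : r = s
        · subst hrs; simp
        · simp [Function.update_of_ne hrs, hvw r ((Finset.mem_insert.1 hr).resolve_left hrs)])
      (fun v r t t' => by
        by_cases hrs : r = s
        · subst hrs; simp [hF's, hM]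
        · have hin : ∀ t, Integrable
              (fun t₁ => F (Function.update (Function.update v s t₁) r t)) ν := fun t => by
            have h := hinner (Function.update v r t)
            simp only [hcomm _ _ _ _ hrs] at h
            exact h
          rw [← Real.norm_eq_abs]
          simp only [hF', hcomm _ _ _ _ hrs]
          rw [← integral_sub (hin t) (hin t')]
          refine (norm_integral_le_of_norm_le_const (C := M)
            (ae_of_all _ fun t₁ => hosc _ r t t')).trans ?_
          simp)
      (fun v r t ht => by
        by_cases hrs : r = s
        · subst hrs; simp [hF's]
        · simp only [hF', hcomm _ _ _ _ hrs]
          exact integral_congr_ae (ae_of_all _ fun t₁ => hconst _ r t ht))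
    have hexpb : ∀ v, |Real.exp (l * F v)| ≤ Real.exp (l * K) := fun v => by
      rw [abs_of_pos (Real.exp_pos _)]
      gcongr
      exact (abs_le.1 (hb v)).2
    rw [hfub (fun v => Real.exp (l * F v)) (by fun_prop) ⟨_, hexpb⟩]
    calc ∫ v, ∫ t, Real.exp (l * F (Function.update v s t)) ∂ν ∂(Measure.pi fun _ : ι => ν)
        ≤ ∫ v, Real.exp (l * F' v) * Real.exp (l ^ 2 * M ^ 2 * p)
            ∂(Measure.pi fun _ : ι => ν) := by
          refine integral_mono_of_nonneg
            (ae_of_all _ fun v => integral_nonneg fun t => (Real.exp_pos _).le) ?_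
            (ae_of_all _ fun v => ?_)
          · refine Integrable.mul_const (Integrable.of_bound (by fun_prop) (Real.exp (l * K))
              (ae_of_all _ fun v => ?_)) _
            rw [Real.norm_eq_abs, abs_of_pos (Real.exp_pos _)]
            gcongr
            exact (abs_le.1 (hF'b v)).2
          · simp only
            rw [← Real.exp_add]
            exact integral_exp_le_of_const
              (hm2.comp (measurable_const.prodMk measurable_id))
              (fun t t' => hosc v s t t') (fun t ht => hconst v s t ht) hp hl hlM
      _ ≤ _ := by
          rw [integral_mul_const, hIF, Finset.card_insert_of_notMem hs]
          calc _ ≤ _ := mul_le_mul_of_nonneg_right hih (Real.exp_pos _).le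
            _ = _ := by rw [← Real.exp_add]; push_cast; ring_nf

/-- The tail bound that follows from the exponential moment, with the free parameter `l`. -/
theorem measure_lt_le_of_bounded_differences (S : Finset ι) {M x p l K d : ℝ}
    (hp : ν.real (Set.Iio x) ≤ p) (hl : 0 ≤ l) (hlM : l * M ≤ 1)
    (F : (ι → ℝ) → ℝ) (hF : Measurable F) (hb : ∀ v, |F v| ≤ K)
    (hdep : ∀ v w, (∀ s ∈ S, v s = w s) → F v = F w)
    (hosc : ∀ v s t t', |F (Function.update v s t) - F (Function.update v s t')| ≤ M)
    (hconst : ∀ v s t, x ≤ t → F (Function.update v s t) = F (Function.update v s x)) :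
    (Measure.pi fun _ : ι => ν).real
        {v | (∫ v, F v ∂(Measure.pi fun _ : ι => ν)) + d ≤ F v} ≤
      Real.exp (-(l * d) + S.card * (l ^ 2 * M ^ 2 * p)) := by
  have h1 := integral_exp_le_of_bounded_differences S hp hl hlM F hF hb hdep hosc hconst
  set e := ∫ v, F v ∂(Measure.pi fun _ : ι => ν)
  have hint : Integrable (fun v => Real.exp (l * F v)) (Measure.pi fun _ : ι => ν) := by
    refine Integrable.of_bound (by fun_prop) (Real.exp (l * K)) (ae_of_all _ fun v => ?_)
    rw [Real.norm_eq_abs, abs_of_pos (Real.exp_pos _)]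
    gcongr
    exact (abs_le.1 (hb v)).2
  have h2 := mul_meas_ge_le_integral_of_nonneg (μ := Measure.pi fun _ : ι => ν)
    (ae_of_all _ fun v => (Real.exp_pos (l * F v)).le) hint (Real.exp (l * (e + d)))
  have h3 : {v | e + d ≤ F v} ⊆ {v | Real.exp (l * (e + d)) ≤ Real.exp (l * F v)} :=
    fun v hv => Real.exp_le_exp.2 (mul_le_mul_of_nonneg_left hv hl)
  have h4 := (mul_le_mul_of_nonneg_left (measureReal_mono h3 (measure_ne_top _ _))
    (Real.exp_pos (l * (e + d))).le).trans (h2.trans h1)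
  rw [← le_div_iff₀' (Real.exp_pos _), ← Real.exp_sub] at h4
  refine h4.trans (Real.exp_le_exp.2 (le_of_eq (by ring)))

end ProductMeasure

/-! ### The uniform distribution -/

/-- The uniform distribution on `[0, 1]`. -/
abbrev unifMeasure : Measure ℝ := volume.restrict (Set.Icc 0 1)

instance : IsProbabilityMeasure unifMeasure := ⟨by simp⟩

theorem unifMeasure_ae_mem_Icc : ∀ᵐ t ∂unifMeasure, 0 ≤ t ∧ t ≤ 1 :=
  (ae_restrict_mem measurableSet_Icc).mono fun _ h => h

theorem unifMeasure_Iio {x : ℝ} (h0 : 0 ≤ x) (h1 : x ≤ 1) :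
    unifMeasure.real (Set.Iio x) = x := by
  have : Set.Iio x ∩ Set.Icc 0 1 = Set.Ico 0 x := by
    ext t; simp only [Set.mem_inter_iff, Set.mem_Iio, Set.mem_Icc, Set.mem_Ico]
    constructor
    · rintro ⟨a, b, c⟩; exact ⟨b, a⟩
    · rintro ⟨a, b⟩; exact ⟨b, a, by linarith⟩
  rw [Measure.real, Measure.restrict_apply measurableSet_Iio, this, Real.volume_Ico]
  simp [h0]

theorem unifMeasure_le_max {y : ℝ} (h1 : y ≤ 1) :
    unifMeasure.real {t | y ≤ max t 0} = 1 - max y 0 := by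
  rcases le_or_gt y 0 with h | h
  · have : {t : ℝ | y ≤ max t 0} = Set.univ := by ext t; simp [h]
    rw [this]; simp [h]
  · have : {t : ℝ | y ≤ max t 0} = (Set.Iio y)ᶜ := by
      ext t; simp [h.not_ge]
    rw [this, probReal_compl_eq_one_sub measurableSet_Iio, unifMeasure_Iio h.le h1,
      max_eq_left h.le]

theorem integral_unif_max_pow {c : ℝ} (h1 : c ≤ 1) (k : ℕ) :
    ∫ t, (max (c - t) 0) ^ (k + 1) ∂unifMeasure = (max c 0) ^ (k + 2) / (k + 2) := by
  rw [integral_Icc_eq_integral_Ioc, ← intervalIntegral.integral_of_le zero_le_one]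
  rcases le_or_gt c 0 with h | h
  · rw [max_eq_right h]
    have : ∫ t in (0 : ℝ)..1, (max (c - t) 0) ^ (k + 1) = ∫ t in (0 : ℝ)..1, (0 : ℝ) := by
      refine intervalIntegral.integral_congr fun t ht => ?_
      rw [Set.uIcc_of_le zero_le_one] at ht
      rw [max_eq_right (by linarith [ht.1])]
      simp
    rw [this]; simp
  · have hc : ∀ u w : ℝ, IntervalIntegrable (fun t => (max (c - t) 0) ^ (k + 1)) volume u w :=
      fun u w => Continuous.intervalIntegrable (by fun_prop) u w
    rw [← intervalIntegral.integral_add_adjacent_intervals (hc 0 c) (hc c 1)]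
    have e1 : ∫ t in (0 : ℝ)..c, (max (c - t) 0) ^ (k + 1) =
        ∫ t in (0 : ℝ)..c, (c - t) ^ (k + 1) := by
      refine intervalIntegral.integral_congr fun t ht => ?_
      rw [Set.uIcc_of_le h.le] at ht
      rw [max_eq_left (by linarith [ht.2])]
    have e2 : ∫ t in c..1, (max (c - t) 0) ^ (k + 1) = ∫ t in c..1, (0 : ℝ) := by
      refine intervalIntegral.integral_congr fun t ht => ?_
      rw [Set.uIcc_of_le h1] at ht
      rw [max_eq_right (by linarith [ht.1])]
      simp
    rw [e1, e2, intervalIntegral.integral_comp_sub_left (fun t => t ^ (k + 1)), integral_pow]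
    simp [max_eq_left h.le]
    ring

theorem pi_unif_ae_nonneg {ι : Type*} [Fintype ι] : ∀ᵐ v ∂(Measure.pi fun _ : ι => unifMeasure), ∀ s, 0 ≤ v s := by
  rw [ae_all_iff]
  intro s
  exact (measurePreserving_eval (fun _ : ι => unifMeasure) s).quasiMeasurePreserving.ae
    (unifMeasure_ae_mem_Icc.mono fun _ h => h.1)

section

variable {ι : Type*} [Fintype ι] [DecidableEq ι]

/-- The mean of `(x - a - b)⁺` for independent uniform `a`, `b`. -/
theorem integral_triangle {s t : ι} (hst : s ≠ t) {x : ℝ} (h0 : 0 ≤ x) (h1 : x ≤ 1) :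
    ∫ v, max (x - v s - v t) 0 ∂(Measure.pi fun _ : ι => unifMeasure) = x ^ 3 / 6 := by
  have h := measurePreserving_piecewise (ι := ι) unifMeasure {t}
  have hb : ∀ᵐ v ∂(Measure.pi fun _ : ι => unifMeasure), |max (x - v s - v t) 0| ≤ x := by
    filter_upwards [pi_unif_ae_nonneg] with v hv
    rw [abs_of_nonneg (le_max_right _ _)]
    exact max_le (by linarith [hv s, hv t]) h0
  have hint : Integrable (fun v : ι → ℝ => max (x - v s - v t) 0)
      (Measure.pi fun _ : ι => unifMeasure) :=
    Integrable.of_bound (by fun_prop) x hb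
  rw [← h.map_eq] at hint
  rw [← h.map_eq, integral_map h.measurable.aemeasurable (by fun_prop)]
  rw [integrable_map_measure (by fun_prop) h.measurable.aemeasurable] at hint
  simp only [Function.comp_def] at hint
  have hs : s ∉ ({t} : Finset ι) := by simpa using hst
  rw [integral_prod _ hint]
  simp only [Finset.piecewise, hs, if_false, Finset.mem_singleton, if_true]
  have e1 : ∀ v : ι → ℝ, ∫ w, max (x - v s - w t) 0 ∂(Measure.pi fun _ : ι => unifMeasure) =
      ∫ b, max (x - v s - b) 0 ∂unifMeasure := fun v =>
    integral_comp_eval (μ := fun _ : ι => unifMeasure) (i := t)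
      (f := fun b => max (x - v s - b) 0) (by fun_prop)
  have e2 : ∫ v : ι → ℝ, (∫ b, max (x - v s - b) 0 ∂unifMeasure)
      ∂(Measure.pi fun _ : ι => unifMeasure) =
      ∫ v : ι → ℝ, (max (x - v s) 0) ^ 2 / 2 ∂(Measure.pi fun _ : ι => unifMeasure) := by
    refine integral_congr_ae ?_
    filter_upwards [pi_unif_ae_nonneg] with v hv
    have := integral_unif_max_pow (c := x - v s) (by linarith [hv s]) 0
    simpa using this
  have e3 : ∫ v : ι → ℝ, (max (x - v s) 0) ^ 2 / 2 ∂(Measure.pi fun _ : ι => unifMeasure) =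
      ∫ a, (max (x - a) 0) ^ 2 / 2 ∂unifMeasure :=
    integral_comp_eval (μ := fun _ : ι => unifMeasure) (i := s)
      (f := fun a => (max (x - a) 0) ^ 2 / 2) (by fun_prop)
  simp only [e1]
  rw [e2, e3, integral_div]
  have := integral_unif_max_pow h1 1
  simp only [max_eq_left h0] at this
  rw [show (2 : ℕ) = 1 + 1 from rfl, this]
  norm_num
  ring

end

/-- The second-order upper bound for `exp (-s)` around `m`; its linear part has mean `exp (-m)`
when `s` has mean `m`. -/
theorem exp_neg_le_tangent_add_sq {s m : ℝ} (hs : 0 ≤ s) (hm : 0 ≤ m) :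
    Real.exp (-s) ≤ Real.exp (-m) * (1 - (s - m)) + (s - m) ^ 2 := by
  have hm1 : Real.exp (-m) ≤ 1 := Real.exp_le_one_iff.2 (by linarith)
  have hmp := Real.exp_pos (-m)
  rcases le_total m s with h | h
  · have h1 : Real.exp (-(s - m)) ≤ 1 - (s - m) + (s - m) ^ 2 := by
      rcases le_total (s - m) 1 with h2 | h2
      · have := (abs_le.1 (Real.abs_exp_sub_one_sub_id_le (x := -(s - m))
          (by rw [abs_neg, abs_of_nonneg (by linarith)]; exact h2))).2
        nlinarith
      · have : Real.exp (-(s - m)) ≤ 1 := Real.exp_le_one_iff.2 (by linarith)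
        nlinarith
    have h3 : Real.exp (-s) = Real.exp (-m) * Real.exp (-(s - m)) := by
      rw [← Real.exp_add]; ring_nf
    rw [h3]
    nlinarith [mul_le_mul_of_nonneg_left h1 hmp.le, sq_nonneg (s - m),
      mul_le_mul_of_nonneg_right hm1 (sq_nonneg (s - m))]
  · have h1 : 1 - (m - s) ≤ Real.exp (-(m - s)) := by
      linarith [Real.add_one_le_exp (-(m - s))]
    have h3 : Real.exp (-m) = Real.exp (-s) * Real.exp (-(m - s)) := by
      rw [← Real.exp_add]; ring_nf
    have hs1 : Real.exp (-s) ≤ 1 := Real.exp_le_one_iff.2 (by linarith)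
    have h4 : 1 - (m - s) ^ 2 ≤ Real.exp (-(m - s)) * (1 + (m - s)) := by nlinarith
    rw [h3]
    nlinarith [mul_le_mul_of_nonneg_left h4 (Real.exp_pos (-s)).le,
      mul_le_mul_of_nonneg_right hs1 (sq_nonneg (m - s))]

/-! ### The avoidance probability -/

/-- The index set of the family `costFamily` of all costs. -/
abbrev CostIdx (n : ℕ) := (Fin n × Fin n) ⊕ (Fin n × Fin n) ⊕ (Fin n × Fin n)

/-- The law of the whole family of costs. -/
abbrev costLaw (n : ℕ) : Measure (CostIdx n → ℝ) := Measure.pi fun _ => unifMeasure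

/-- The index of the cost `a i j`. -/
abbrev aIdx {n : ℕ} (i j : Fin n) : CostIdx n := Sum.inl (i, j)
/-- The index of the cost `b i k`. -/
abbrev bIdx {n : ℕ} (i k : Fin n) : CostIdx n := Sum.inr (Sum.inl (i, k))
/-- The index of the cost `c j k`. -/
abbrev cIdx {n : ℕ} (j k : Fin n) : CostIdx n := Sum.inr (Sum.inr (j, k))

/-- The costs `W i j k` as a function of the whole family of costs. -/
def costAt {n : ℕ} (v : CostIdx n → ℝ) (i j k : Fin n) : ℝ :=
  v (aIdx i j) + v (bIdx i k) + v (cIdx j k)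

/-- The probability, over the costs `a i ·` and `b i ·` of row `i` and for fixed costs `c`, that
all triples `(i, j, k)` in `{i} × B × C` cost at least `x`. The costs `c` are read off `v` and
truncated at `0`, which almost surely changes nothing; it makes the bounds on the oscillation in
`v` hold for every `v`. -/
def avoidProb {n : ℕ} (i : Fin n) (B C : Finset (Fin n)) (x : ℝ) (v : CostIdx n → ℝ) : ℝ :=
  (costLaw n).real {w | ∀ j ∈ B, ∀ k ∈ C,
    x ≤ w (aIdx i j) + w (bIdx i k) + max (v (cIdx j k)) 0}

variable {n : ℕ}

theorem measurableSet_avoid (i : Fin n) (B C : Finset (Fin n)) (x : ℝ) :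
    MeasurableSet {q : (CostIdx n → ℝ) × (CostIdx n → ℝ) | ∀ j ∈ B, ∀ k ∈ C,
      x ≤ q.2 (aIdx i j) + q.2 (bIdx i k) + max (q.1 (cIdx j k)) 0} := by
  simp only [measurableSet_setOfPred]
  measurability

theorem measurable_avoidProb (i : Fin n) (B C : Finset (Fin n)) (x : ℝ) :
    Measurable (avoidProb i B C x) :=
  (measurable_measure_prodMk_left (measurableSet_avoid i B C x)).ennreal_toReal

theorem avoidProb_nonneg (i : Fin n) (B C : Finset (Fin n)) (x : ℝ) (v) :
    0 ≤ avoidProb i B C x v := measureReal_nonneg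

theorem avoidProb_le_one (i : Fin n) (B C : Finset (Fin n)) (x : ℝ) (v) :
    avoidProb i B C x v ≤ 1 := measureReal_le_one

theorem abs_avoidProb_le (i : Fin n) (B C : Finset (Fin n)) (x : ℝ) (v) :
    |avoidProb i B C x v| ≤ 1 :=
  abs_le.2 ⟨by linarith [avoidProb_nonneg i B C x v], avoidProb_le_one i B C x v⟩

/-- The indices of the costs `a i ·` and `b i ·`. -/
def rowIdx (i : Fin n) : Finset (CostIdx n) :=
  Finset.univ.filter fun s => ∃ j, s = aIdx i j ∨ s = bIdx i j

theorem aIdx_mem_rowIdx (i j : Fin n) : aIdx i j ∈ rowIdx i := by simp [rowIdx]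
theorem bIdx_mem_rowIdx (i j : Fin n) : bIdx i j ∈ rowIdx i := by simp [rowIdx]
theorem cIdx_notMem_rowIdx (i j k : Fin n) : cIdx j k ∉ rowIdx i := by simp [rowIdx]
theorem aIdx_notMem_rowIdx {i i' : Fin n} (h : i' ≠ i) (j : Fin n) : aIdx i' j ∉ rowIdx i := by
  simp [rowIdx, h]
theorem bIdx_notMem_rowIdx {i i' : Fin n} (h : i' ≠ i) (j : Fin n) : bIdx i' j ∉ rowIdx i := by
  simp [rowIdx, h]

theorem measurableSet_forall_le_costAt (i : Fin n) (B C : Finset (Fin n)) (x : ℝ) :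
    MeasurableSet {v : CostIdx n → ℝ | ∀ j ∈ B, ∀ k ∈ C, x ≤ costAt v i j k} := by
  simp only [measurableSet_setOfPred, costAt]
  measurability

/-- Row `i` is independent of every event `A` that does not involve it. -/
theorem measureReal_inter_avoid (i : Fin n) (B C : Finset (Fin n)) (x : ℝ)
    {A : Set (CostIdx n → ℝ)} (hA : MeasurableSet A)
    (hAi : ∀ v w, (rowIdx i).piecewise w v ∈ A ↔ v ∈ A) :
    (costLaw n).real (A ∩ {v | ∀ j ∈ B, ∀ k ∈ C, x ≤ costAt v i j k}) =
      ∫ v, A.indicator (avoidProb i B C x) v ∂(costLaw n) := by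
  have h := measurePreserving_piecewise unifMeasure (rowIdx i)
  have hE := measurableSet_forall_le_costAt i B C x
  rw [← h.measureReal_preimage (hA.inter hE).nullMeasurableSet]
  set D : Set ((CostIdx n → ℝ) × (CostIdx n → ℝ)) := (A ×ˢ Set.univ) ∩ {q | ∀ j ∈ B, ∀ k ∈ C,
      x ≤ q.2 (aIdx i j) + q.2 (bIdx i k) + max (q.1 (cIdx j k)) 0} with hD
  have hDm : MeasurableSet D := (hA.prod MeasurableSet.univ).inter (measurableSet_avoid i B C x)
  have h1 : ((fun p : (CostIdx n → ℝ) × (CostIdx n → ℝ) => (rowIdx i).piecewise p.2 p.1) ⁻¹'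
      (A ∩ {v | ∀ j ∈ B, ∀ k ∈ C, x ≤ costAt v i j k})) =ᵐ[(costLaw n).prod (costLaw n)] D := by
    have hnn : ∀ᵐ q ∂((costLaw n).prod (costLaw n)), ∀ s, 0 ≤ q.1 s :=
      Measure.quasiMeasurePreserving_fst.ae pi_unif_ae_nonneg
    filter_upwards [hnn] with q hq
    apply propext
    change (_ ∈ A ∧ ∀ j ∈ B, ∀ k ∈ C, x ≤ costAt ((rowIdx i).piecewise q.2 q.1) i j k) ↔
      ((q.1 ∈ A ∧ q.2 ∈ Set.univ) ∧ ∀ j ∈ B, ∀ k ∈ C,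
        x ≤ q.2 (aIdx i j) + q.2 (bIdx i k) + max (q.1 (cIdx j k)) 0)
    simp [ hAi, costAt, Finset.piecewise, aIdx_mem_rowIdx, bIdx_mem_rowIdx,
      cIdx_notMem_rowIdx, hq]
  rw [measureReal_congr h1, Measure.real, Measure.prod_apply hDm,
    ← integral_toReal (measurable_measure_prodMk_left hDm).aemeasurable
      (ae_of_all _ fun v => measure_lt_top _ _)]
  refine integral_congr_ae (ae_of_all _ fun v => ?_)
  by_cases hv : v ∈ A
  · simp [hD, hv, avoidProb, Measure.real]
  · simp [hD, hv]

theorem measureReal_avoid (i : Fin n) (B C : Finset (Fin n)) (x : ℝ) :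
    (costLaw n).real {v | ∀ j ∈ B, ∀ k ∈ C, x ≤ costAt v i j k} =
      ∫ v, avoidProb i B C x v ∂(costLaw n) := by
  simpa using measureReal_inter_avoid i B C x MeasurableSet.univ (by simp)

/-- The conditional probability, given row `i`, that no triple in `{i} × B × C` costs less than
`x`; the costs `c` of these triples are independent, hence the product. -/
def avoidProd (i : Fin n) (B C : Finset (Fin n)) (x : ℝ) (w : CostIdx n → ℝ) : ℝ :=
  ∏ p ∈ B ×ˢ C, (1 - max (x - w (aIdx i p.1) - w (bIdx i p.2)) 0)

theorem integral_avoidProb (i : Fin n) (B C : Finset (Fin n)) {x : ℝ} (h1 : x ≤ 1) :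
    ∫ v, avoidProb i B C x v ∂(costLaw n) = ∫ w, avoidProd i B C x w ∂(costLaw n) := by
  set D : Set ((CostIdx n → ℝ) × (CostIdx n → ℝ)) := {q | ∀ j ∈ B, ∀ k ∈ C,
      x ≤ q.2 (aIdx i j) + q.2 (bIdx i k) + max (q.1 (cIdx j k)) 0} with hD
  have hDm : MeasurableSet D := measurableSet_avoid i B C x
  have e1 : ∫ v, avoidProb i B C x v ∂(costLaw n) = ((costLaw n).prod (costLaw n)).real D := by
    rw [Measure.real, Measure.prod_apply hDm,
      ← integral_toReal (measurable_measure_prodMk_left hDm).aemeasurable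
        (ae_of_all _ fun v => measure_lt_top _ _)]
    rfl
  rw [e1, Measure.real, Measure.prod_apply_symm hDm,
    ← integral_toReal (measurable_measure_prodMk_right hDm).aemeasurable
      (ae_of_all _ fun v => measure_lt_top _ _)]
  refine integral_congr_ae ?_
  filter_upwards [pi_unif_ae_nonneg] with w hw
  have hinj : Set.InjOn (fun p : Fin n × Fin n => cIdx p.1 p.2) (B ×ˢ C : Finset _) := by
    intro p _ q _ h
    simpa using h
  have e2 := pi_real_forall_mem (ν := unifMeasure)
    ((B ×ˢ C).image fun p : Fin n × Fin n => cIdx p.1 p.2)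
    (fun s => {t | (match s with
      | Sum.inr (Sum.inr p) => x - w (aIdx i p.1) - w (bIdx i p.2)
      | _ => 0) ≤ max t 0})
  rw [Finset.prod_image hinj] at e2
  have e3 : (fun v => (v, w)) ⁻¹' D = {v : CostIdx n → ℝ |
      ∀ s ∈ (B ×ˢ C).image fun p : Fin n × Fin n => cIdx p.1 p.2,
        v s ∈ {t : ℝ | (match s with
      | Sum.inr (Sum.inr p) => x - w (aIdx i p.1) - w (bIdx i p.2)
      | _ => 0) ≤ max t 0}} := by
    ext v
    simp only [hD, Set.mem_preimage, Set.mem_ofPred_eq, Finset.mem_image, Finset.mem_product]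
    constructor
    · rintro h _ ⟨p, ⟨hp1, hp2⟩, rfl⟩
      have := h p.1 hp1 p.2 hp2
      simp only
      linarith
    · intro h j hj k hk
      have := h (cIdx j k) ⟨(j, k), ⟨hj, hk⟩, rfl⟩
      simp only at this
      linarith
  rw [e3]
  refine e2.trans (Finset.prod_congr rfl fun p _ => ?_)
  exact unifMeasure_le_max (by linarith [hw (aIdx i p.1), hw (bIdx i p.2)])

/-! ### Bounds on the mean avoidance probability -/

/-- The expected number, given row `i`, of triples in `{i} × B × C` of cost less than `x`. -/
def hitSum (i : Fin n) (B C : Finset (Fin n)) (x : ℝ) (w : CostIdx n → ℝ) : ℝ :=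
  ∑ p ∈ B ×ˢ C, max (x - w (aIdx i p.1) - w (bIdx i p.2)) 0

theorem measurable_hitSum (i : Fin n) (B C : Finset (Fin n)) (x : ℝ) :
    Measurable (hitSum i B C x) := by
  unfold hitSum; fun_prop

theorem measurable_avoidProd (i : Fin n) (B C : Finset (Fin n)) (x : ℝ) :
    Measurable (avoidProd i B C x) := by
  unfold avoidProd; fun_prop

theorem integrable_max_sub (i : Fin n) (x : ℝ) (h0 : 0 ≤ x) (p : Fin n × Fin n) :
    Integrable (fun w => max (x - w (aIdx i p.1) - w (bIdx i p.2)) 0) (costLaw n) := by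
  refine Integrable.of_bound (by fun_prop) x ?_
  filter_upwards [pi_unif_ae_nonneg] with v hv
  rw [Real.norm_eq_abs, abs_of_nonneg (le_max_right _ _)]
  exact max_le (by linarith [hv (aIdx i p.1), hv (bIdx i p.2)]) h0

theorem integral_hitSum (i : Fin n) (B C : Finset (Fin n)) {x : ℝ} (h0 : 0 ≤ x) (h1 : x ≤ 1) :
    ∫ w, hitSum i B C x w ∂(costLaw n) = B.card * C.card * (x ^ 3 / 6) := by
  unfold hitSum
  rw [integral_finsetSum _ fun p _ => integrable_max_sub i x h0 p,
    Finset.sum_congr rfl fun p _ => integral_triangle (by simp) h0 h1]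
  simp

theorem integrable_hitSum (i : Fin n) (B C : Finset (Fin n)) {x : ℝ} (h0 : 0 ≤ x) :
    Integrable (hitSum i B C x) (costLaw n) :=
  integrable_finsetSum _ fun p _ => integrable_max_sub i x h0 p

theorem hitSum_nonneg (i : Fin n) (B C : Finset (Fin n)) (x : ℝ) (w) : 0 ≤ hitSum i B C x w :=
  Finset.sum_nonneg fun _ _ => le_max_right _ _

/-- Two terms of `hitSum` are independent unless they share an index. -/
theorem integral_max_mul_max_le (i : Fin n) {x : ℝ} (h0 : 0 ≤ x) (h1 : x ≤ 1)
    (p q : Fin n × Fin n) :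
    ∫ w, max (x - w (aIdx i p.1) - w (bIdx i p.2)) 0 *
        max (x - w (aIdx i q.1) - w (bIdx i q.2)) 0 ∂(costLaw n) ≤
      (x ^ 3 / 6) ^ 2 + (if p.1 = q.1 then x ^ 5 else 0) + (if p.2 = q.2 then x ^ 5 else 0) +
        (if p = q then x ^ 4 else 0) := by
  obtain ⟨j, k⟩ := p
  obtain ⟨j', k'⟩ := q
  simp only [Prod.mk.injEq]
  -- the product vanishes unless all the costs involved are below `x`
  have key : ∀ T : Finset (CostIdx n), T ⊆ {aIdx i j, bIdx i k, aIdx i j', bIdx i k'} →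
      ∫ w, max (x - w (aIdx i j) - w (bIdx i k)) 0 *
        max (x - w (aIdx i j') - w (bIdx i k')) 0 ∂(costLaw n) ≤ x ^ (T.card + 2) := by
    intro T hT
    have hm : MeasurableSet {v : CostIdx n → ℝ | ∀ s ∈ T, v s < x} := by
      simp only [measurableSet_setOfPred]; measurability
    calc _ ≤ ∫ w, {v : CostIdx n → ℝ | ∀ s ∈ T, v s < x}.indicator (fun _ => x ^ 2) w
            ∂(costLaw n) := by
          refine integral_mono_of_nonneg (ae_of_all _ fun w => mul_nonneg (le_max_right _ _)
            (le_max_right _ _)) ((integrable_const _).indicator hm) ?_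
          filter_upwards [pi_unif_ae_nonneg] with w hw
          by_cases hx : ∀ s ∈ T, w s < x
          · rw [Set.indicator_of_mem (by exact hx), sq]
            refine mul_le_mul (max_le ?_ h0) (max_le ?_ h0) (le_max_right _ _) h0
            · linarith [hw (aIdx i j), hw (bIdx i k)]
            · linarith [hw (aIdx i j'), hw (bIdx i k')]
          · rw [Set.indicator_of_notMem (by exact hx)]
            push Not at hx
            obtain ⟨s, hs, hxs⟩ := hx
            have hs' := hT hs
            simp only [Finset.mem_insert, Finset.mem_singleton] at hs'
            have hz : ∀ u t : ℝ, 0 ≤ u → 0 ≤ t → (x ≤ u ∨ x ≤ t) → max (x - u - t) 0 = 0 := by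
              intro u t hu ht h
              exact max_eq_right (by rcases h with h | h <;> linarith)
            rcases hs' with rfl | rfl | rfl | rfl
            · rw [hz _ _ (hw _) (hw _) (Or.inl hxs)]; simp
            · rw [hz _ _ (hw _) (hw _) (Or.inr hxs)]; simp
            · rw [hz (w (aIdx i j')) _ (hw _) (hw _) (Or.inl hxs)]; simp
            · rw [hz (w (aIdx i j')) _ (hw _) (hw _) (Or.inr hxs)]; simp
      _ = x ^ (T.card + 2) := by
          rw [integral_indicator hm, setIntegral_const]
          have := pi_real_forall_mem (ν := unifMeasure) T (fun _ => Set.Iio x)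
          simp only [Set.mem_Iio, unifMeasure_Iio h0 h1, Finset.prod_const] at this
          rw [this, smul_eq_mul, ← pow_add]
  have x3 : 0 ≤ (x ^ 3 / 6) ^ 2 := sq_nonneg _
  have x5 : 0 ≤ x ^ 5 := pow_nonneg h0 _
  have x4 : 0 ≤ x ^ 4 := pow_nonneg h0 _
  by_cases hj : j = j'
  · subst hj
    by_cases hk : k = k'
    · subst hk
      have := key {aIdx i j, bIdx i k} (by intro s; simp)
      rw [Finset.card_pair (by simp)] at this
      simp only [and_self, if_true]
      norm_num at this
      linarith
    · have := key {aIdx i j, bIdx i k, bIdx i k'} (by intro s; simp; tauto)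
      rw [Finset.card_eq_three.2 ⟨_, _, _, by simp, by simp, by simpa using hk, rfl⟩] at this
      simp only [hk, if_true, if_false, and_false]
      norm_num at this
      linarith
  · by_cases hk : k = k'
    · subst hk
      have := key {aIdx i j, bIdx i k, aIdx i j'} (by intro s; simp; tauto)
      rw [Finset.card_eq_three.2 ⟨_, _, _, by simp, by simpa using hj, by simp, rfl⟩] at this
      simp only [hj, if_true, if_false, false_and]
      norm_num at this
      linarith
    · simp only [hj, hk, if_false, false_and]
      rw [integral_mul_eq_of_piecewise ({aIdx i j', bIdx i k'} : Finset (CostIdx n))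
        (by fun_prop) (by fun_prop) (fun v w => by simp [Finset.piecewise, hj, hk])
        (fun v w => by simp [Finset.piecewise]), integral_triangle (by simp) h0 h1,
        integral_triangle (by simp) h0 h1]
      linarith

theorem integral_hitSum_sq_le (i : Fin n) {B C : Finset (Fin n)} {m : ℕ} (hB : B.card = m)
    (hC : C.card = m) {x : ℝ} (h0 : 0 ≤ x) (h1 : x ≤ 1) :
    ∫ w, hitSum i B C x w ^ 2 ∂(costLaw n) ≤
      (m ^ 2 * (x ^ 3 / 6)) ^ 2 + 2 * m ^ 3 * x ^ 5 + m ^ 2 * x ^ 4 := by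
  have hint : ∀ p q : Fin n × Fin n, Integrable (fun w : CostIdx n → ℝ =>
      max (x - w (aIdx i p.1) - w (bIdx i p.2)) 0 *
        max (x - w (aIdx i q.1) - w (bIdx i q.2)) 0) (costLaw n) := by
    intro p q
    refine Integrable.of_bound (by fun_prop) (x * x) ?_
    filter_upwards [pi_unif_ae_nonneg] with w hw
    rw [Real.norm_eq_abs, abs_of_nonneg (mul_nonneg (le_max_right _ _) (le_max_right _ _))]
    refine mul_le_mul (max_le ?_ h0) (max_le ?_ h0) (le_max_right _ _) h0
    · linarith [hw (aIdx i p.1), hw (bIdx i p.2)]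
    · linarith [hw (aIdx i q.1), hw (bIdx i q.2)]
  unfold hitSum
  simp only [sq (Finset.sum _ _), Finset.sum_mul_sum]
  rw [integral_finsetSum _ fun p _ => integrable_finsetSum _ fun q _ => hint p q]
  simp only [integral_finsetSum _ fun q _ => hint _ q]
  refine (Finset.sum_le_sum fun p _ => Finset.sum_le_sum fun q _ =>
    integral_max_mul_max_le i h0 h1 p q).trans (le_of_eq ?_)
  simp only [Finset.sum_add_distrib]
  have e1 : ∑ p ∈ B ×ˢ C, ∑ q ∈ B ×ˢ C, (if p.1 = q.1 then x ^ 5 else 0) = m ^ 3 * x ^ 5 := by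
    simp [Finset.sum_product_right, hB, hC]
    ring
  have e2 : ∑ p ∈ B ×ˢ C, ∑ q ∈ B ×ˢ C, (if p.2 = q.2 then x ^ 5 else 0) = m ^ 3 * x ^ 5 := by
    simp [Finset.sum_product, hB, hC]
    ring
  have e3 : ∑ p ∈ B ×ˢ C, ∑ q ∈ B ×ˢ C, (if p = q then x ^ 4 else 0) = m ^ 2 * x ^ 4 := by
    simp only [Finset.sum_ite_eq, Finset.sum_ite_mem, Finset.inter_self, Finset.sum_const,
      Finset.card_product, hB, hC, nsmul_eq_mul]
    push_cast
    ring
  rw [e1, e2, e3]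
  simp [hB, hC]
  ring

theorem avoidProd_bounds (i : Fin n) (B C : Finset (Fin n)) {x : ℝ} (h1 : x ≤ 1) :
    ∀ᵐ w ∂(costLaw n), 0 ≤ avoidProd i B C x w ∧ avoidProd i B C x w ≤ 1 ∧
      avoidProd i B C x w ≤ Real.exp (-hitSum i B C x w) := by
  filter_upwards [pi_unif_ae_nonneg] with w hw
  have hx : ∀ p : Fin n × Fin n, max (x - w (aIdx i p.1) - w (bIdx i p.2)) 0 ≤ 1 := fun p =>
    max_le (by linarith [hw (aIdx i p.1), hw (bIdx i p.2)]) zero_le_one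
  have hp : ∀ p : Fin n × Fin n, 0 ≤ max (x - w (aIdx i p.1) - w (bIdx i p.2)) 0 := fun p =>
    le_max_right _ _
  refine ⟨Finset.prod_nonneg fun p _ => by linarith [hx p],
    Finset.prod_le_one (fun p _ => by linarith [hx p]) (fun p _ => by linarith [hp p]), ?_⟩
  rw [hitSum, ← Finset.sum_neg_distrib, Real.exp_sum]
  exact Finset.prod_le_prod (fun p _ => by linarith [hx p])
    (fun p _ => Real.one_sub_le_exp_neg _)

/-- The Poisson approximation of the mean avoidance probability, with a second-moment error. -/
theorem integral_avoidProb_le (i : Fin n) {B C : Finset (Fin n)} {m : ℕ} (hB : B.card = m)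
    (hC : C.card = m) {x : ℝ} (h0 : 0 ≤ x) (h1 : x ≤ 1) :
    ∫ v, avoidProb i B C x v ∂(costLaw n) ≤
      Real.exp (-(m ^ 2 * (x ^ 3 / 6))) + (2 * m ^ 3 * x ^ 5 + m ^ 2 * x ^ 4) := by
  rw [integral_avoidProb i B C h1]
  set μ : ℝ := m ^ 2 * (x ^ 3 / 6) with hμ
  have hμ0 : 0 ≤ μ := by positivity
  have hS := integrable_hitSum i B C h0
  have hmean : ∫ w, hitSum i B C x w ∂(costLaw n) = μ := by
    rw [integral_hitSum i B C h0 h1, hB, hC]; ring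
  have hSq : Integrable (fun w => hitSum i B C x w ^ 2) (costLaw n) := by
    refine Integrable.of_bound (by have := measurable_hitSum i B C x; fun_prop)
      ((∑ p ∈ B ×ˢ C, x) ^ 2) ?_
    filter_upwards [pi_unif_ae_nonneg] with w hw
    rw [Real.norm_eq_abs, abs_of_nonneg (sq_nonneg _)]
    refine pow_le_pow_left₀ (hitSum_nonneg _ _ _ _ _) (Finset.sum_le_sum fun p _ => ?_) 2
    exact max_le (by linarith [hw (aIdx i p.1), hw (bIdx i p.2)]) h0
  have hrhs : ∀ w, Real.exp (-μ) * (1 - (hitSum i B C x w - μ)) + (hitSum i B C x w - μ) ^ 2 =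
      (Real.exp (-μ) * (1 + μ) + μ ^ 2) +
        ((-Real.exp (-μ) - 2 * μ) * hitSum i B C x w + hitSum i B C x w ^ 2) :=
    fun w => by ring
  calc ∫ w, avoidProd i B C x w ∂(costLaw n)
      ≤ ∫ w, (Real.exp (-μ) * (1 + μ) + μ ^ 2) +
        ((-Real.exp (-μ) - 2 * μ) * hitSum i B C x w + hitSum i B C x w ^ 2) ∂(costLaw n) := by
        refine integral_mono_of_nonneg ?_
          ((integrable_const _).add ((hS.const_mul _).add hSq)) ?_
        · filter_upwards [avoidProd_bounds i B C h1] with w hw using hw.1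
        · filter_upwards [avoidProd_bounds i B C h1] with w hw
          rw [← hrhs]
          exact hw.2.2.trans (exp_neg_le_tangent_add_sq (hitSum_nonneg _ _ _ _ _) hμ0)
    _ = Real.exp (-μ) - μ ^ 2 + ∫ w, hitSum i B C x w ^ 2 ∂(costLaw n) := by
        have h4 : Integrable (fun w => (-Real.exp (-μ) - 2 * μ) * hitSum i B C x w +
          hitSum i B C x w ^ 2) (costLaw n) := (hS.const_mul _).add hSq
        rw [integral_add (integrable_const _) h4, integral_add (hS.const_mul _) hSq,
          integral_const_mul, hmean]
        simp
        ring
    _ ≤ _ := by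
        have := integral_hitSum_sq_le i hB hC h0 h1
        rw [← hμ] at this
        linarith

/-- A lower bound for the mean avoidance probability: `1 - y ≥ exp (-y / (1 - x))` for
`0 ≤ y ≤ x`, and Jensen's inequality for `exp`. -/
theorem le_integral_avoidProb (i : Fin n) (B C : Finset (Fin n)) {x : ℝ} (h0 : 0 ≤ x)
    (h1 : x < 1) :
    Real.exp (-(B.card * C.card * (x ^ 3 / 6) / (1 - x))) ≤
      ∫ v, avoidProb i B C x v ∂(costLaw n) := by
  rw [integral_avoidProb i B C h1.le]
  set μ : ℝ := B.card * C.card * (x ^ 3 / 6) / (1 - x) with hμ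
  have hS := integrable_hitSum i B C h0
  have h1x : 0 < 1 - x := by linarith
  -- the tangent of `exp` at the mean of the exponent, which turns into `exp (-μ)` under `∫`
  have hpt : ∀ᵐ w ∂(costLaw n), Real.exp (-μ) * (1 + μ) +
      (-Real.exp (-μ) / (1 - x)) * hitSum i B C x w ≤ avoidProd i B C x w := by
    filter_upwards [pi_unif_ae_nonneg] with w hw
    have hstep : Real.exp (-(hitSum i B C x w / (1 - x))) ≤ avoidProd i B C x w := by
      rw [hitSum, Finset.sum_div, ← Finset.sum_neg_distrib, Real.exp_sum]
      refine Finset.prod_le_prod (fun p _ => (Real.exp_pos _).le) fun p _ => ?_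
      set y := max (x - w (aIdx i p.1) - w (bIdx i p.2)) 0
      have hy0 : 0 ≤ y := le_max_right _ _
      have hyx : y ≤ x := max_le (by linarith [hw (aIdx i p.1), hw (bIdx i p.2)]) h0
      have h2 : 1 / (1 - y) ≤ Real.exp (y / (1 - x)) := by
        have h3 := Real.add_one_le_exp (y / (1 - x))
        have h4 : y / (1 - y) ≤ y / (1 - x) := by gcongr
        have h5 : 1 / (1 - y) = y / (1 - y) + 1 := by
          field_simp [show (1 - y) ≠ 0 by linarith]; ring
        linarith
      rw [Real.exp_neg]
      calc (Real.exp (y / (1 - x)))⁻¹ ≤ (1 / (1 - y))⁻¹ := by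
            gcongr
            exact one_div_pos.2 (by linarith)
        _ = 1 - y := by simp
    refine le_trans ?_ hstep
    have h6 := Real.add_one_le_exp (μ - hitSum i B C x w / (1 - x))
    have h7 : Real.exp (-(hitSum i B C x w / (1 - x))) =
        Real.exp (-μ) * Real.exp (μ - hitSum i B C x w / (1 - x)) := by
      rw [← Real.exp_add]; ring_nf
    rw [h7]
    calc _ = Real.exp (-μ) * (μ - hitSum i B C x w / (1 - x) + 1) := by ring
      _ ≤ _ := by gcongr
  have hA : Integrable (avoidProd i B C x) (costLaw n) := by
    refine Integrable.of_bound (measurable_avoidProd i B C x).aestronglyMeasurable 1 ?_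
    filter_upwards [avoidProd_bounds i B C h1.le] with w hw
    rw [Real.norm_eq_abs, abs_of_nonneg hw.1]
    exact hw.2.1
  have hR : Integrable (fun w => Real.exp (-μ) * (1 + μ) +
      (-Real.exp (-μ) / (1 - x)) * hitSum i B C x w) (costLaw n) :=
    (integrable_const _).add (hS.const_mul _)
  refine le_trans (le_of_eq ?_) (integral_mono_ae hR hA hpt)
  rw [integral_add (integrable_const _) (hS.const_mul _),
    integral_const_mul (-Real.exp (-μ) / (1 - x)),
    integral_hitSum i B C h0 h1.le]
  simp only [integral_const, probReal_univ, smul_eq_mul, one_mul]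
  have : -Real.exp (-μ) / (1 - x) * (↑B.card * ↑C.card * (x ^ 3 / 6)) = - Real.exp (-μ) * μ := by
    rw [hμ]; ring
  rw [this]; ring

/-! ### Concentration of the avoidance probability in the costs `c` -/

theorem measurableSet_avoid_section (i : Fin n) (B C : Finset (Fin n)) (x : ℝ)
    (v : CostIdx n → ℝ) : MeasurableSet {w : CostIdx n → ℝ | ∀ j ∈ B, ∀ k ∈ C,
      x ≤ w (aIdx i j) + w (bIdx i k) + max (v (cIdx j k)) 0} :=
  measurable_prodMk_left (measurableSet_avoid i B C x)

theorem avoidProb_congr (i : Fin n) (B C : Finset (Fin n)) (x : ℝ) {v v' : CostIdx n → ℝ}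
    (h : ∀ j ∈ B, ∀ k ∈ C, v (cIdx j k) = v' (cIdx j k)) :
    avoidProb i B C x v = avoidProb i B C x v' := by
  unfold avoidProb
  congr 1
  ext w
  simp only [Set.mem_ofPred_eq]
  exact forall₂_congr fun j hj => forall₂_congr fun k hk => by rw [h j hj k hk]

theorem avoidProb_update_const (i : Fin n) (B C : Finset (Fin n)) (x : ℝ) (v : CostIdx n → ℝ)
    (s : CostIdx n) {t : ℝ} (ht : x ≤ t) :
    avoidProb i B C x (Function.update v s t) = avoidProb i B C x (Function.update v s x) := by
  unfold avoidProb
  refine measureReal_congr ?_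
  filter_upwards [pi_unif_ae_nonneg] with w hw
  apply propext
  refine forall₂_congr fun j _ => forall₂_congr fun k _ => ?_
  by_cases h : cIdx j k = s
  · subst h
    simp only [Function.update_self]
    have h1 := le_max_left t 0
    have h2 := le_max_left x 0
    have h3 := hw (aIdx i j)
    have h4 := hw (bIdx i k)
    exact ⟨fun _ => by linarith, fun _ => by linarith⟩
  · simp [Function.update_of_ne h]

theorem avoidProb_update_le (i : Fin n) (B C : Finset (Fin n)) {x : ℝ} (h0 : 0 ≤ x) (h1 : x ≤ 1)
    (v : CostIdx n → ℝ) (s : CostIdx n) (t t' : ℝ) :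
    avoidProb i B C x (Function.update v s t) ≤
      avoidProb i B C x (Function.update v s t') + x ^ 2 := by
  have key : ∀ j₀ k₀, s = cIdx j₀ k₀ → avoidProb i B C x (Function.update v s t) ≤
      avoidProb i B C x (Function.update v s t') + x ^ 2 := by
    rintro j₀ k₀ rfl
    have hG := pi_real_forall_mem (ν := unifMeasure)
      ({aIdx i j₀, bIdx i k₀} : Finset (CostIdx n)) (fun _ => Set.Iio x)
    simp only [Set.mem_Iio, unifMeasure_Iio h0 h1, Finset.prod_const] at hG
    rw [Finset.card_pair (by simp)] at hG
    rw [← hG]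
    refine le_trans ?_ (measureReal_union_le _ _)
    refine ENNReal.toReal_mono (measure_ne_top _ _) (measure_mono_ae ?_)
    filter_upwards [pi_unif_ae_nonneg] with w hw hE
    by_cases hx : ∀ s ∈ ({aIdx i j₀, bIdx i k₀} : Finset (CostIdx n)), w s < x
    · exact Or.inr hx
    · left
      intro j hj k hk
      by_cases h : cIdx j k = cIdx j₀ k₀
      · simp only [Sum.inr.injEq, Prod.mk.injEq] at h
        obtain ⟨rfl, rfl⟩ := h
        simp only [Finset.mem_insert, Finset.mem_singleton, forall_eq_or_imp, forall_eq,
          not_and_or, not_lt] at hx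
        have h2 := le_max_right (Function.update v (cIdx j k) t' (cIdx j k)) 0
        have h3 := hw (aIdx i j)
        have h4 := hw (bIdx i k)
        rcases hx with hx | hx <;> linarith
      · have := hE j hj k hk
        rw [Function.update_of_ne h] at this ⊢
        exact this
  rcases s with p | p | p
  · rw [avoidProb_congr i B C x (v' := Function.update v (Sum.inl p) t') (by simp)]
    nlinarith
  · rw [avoidProb_congr i B C x (v' := Function.update v (Sum.inr (Sum.inl p)) t') (by simp)]
    nlinarith
  · exact key p.1 p.2 rfl

theorem measure_avoidProb_ge_le (i : Fin n) {B C : Finset (Fin n)} {m : ℕ} (hm : 0 < m)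
    (hB : B.card = m) (hC : C.card = m) {x X d : ℝ} (h0 : 0 ≤ x) (hxX : x ≤ X) (hX0 : 0 < X)
    (hX1 : X ≤ 1) (hd : 0 ≤ d) (hdX : d ≤ 2 * m ^ 2 * X ^ 3) :
    (costLaw n).real {v | (∫ v, avoidProb i B C x v ∂(costLaw n)) + d ≤ avoidProb i B C x v} ≤
      Real.exp (-(d ^ 2 / (4 * m ^ 2 * X ^ 5))) := by
  have hm' : (0 : ℝ) < m := by exact_mod_cast hm
  have hinj : Set.InjOn (fun p : Fin n × Fin n => cIdx p.1 p.2) (B ×ˢ C : Finset _) := by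
    intro p _ q _ h
    simpa using h
  have hosc := fun v s t t' => avoidProb_update_le i B C h0 (hxX.trans hX1) v s t t'
  have hx2 : x ^ 2 ≤ X ^ 2 := pow_le_pow_left₀ h0 hxX 2
  refine (measure_lt_le_of_bounded_differences (ν := unifMeasure)
    ((B ×ˢ C).image fun p : Fin n × Fin n => cIdx p.1 p.2) (M := X ^ 2) (x := x) (p := X)
    (l := d / (2 * m ^ 2 * X ^ 5)) (K := 1) (by rw [unifMeasure_Iio h0 (hxX.trans hX1)]; exact hxX)
    (by positivity) ?_ _ (measurable_avoidProb i B C x) (abs_avoidProb_le i B C x) ?_ ?_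
    (fun v s t ht => avoidProb_update_const i B C x v s ht)).trans (le_of_eq ?_)
  · rw [div_mul_eq_mul_div, div_le_one (by positivity)]
    nlinarith [mul_le_mul_of_nonneg_right hdX (sq_nonneg X)]
  · intro v w h
    exact avoidProb_congr i B C x fun j hj k hk => h _
      (Finset.mem_image_of_mem (fun p : Fin n × Fin n => cIdx p.1 p.2)
        (Finset.mk_mem_product hj hk))
  · intro v s t t'
    rw [abs_le]
    constructor <;> linarith [hosc v s t t', hosc v s t' t]
  · rw [Finset.card_image_of_injOn hinj, Finset.card_product, hB, hC]
    congr 1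
    push_cast
    field_simp
    ring

/-! ### Disjoint blocks -/

theorem avoidProb_union_le (i : Fin n) {B B' C C' : Finset (Fin n)} (hB : Disjoint B B')
    (hC : Disjoint C C') (x : ℝ) (v : CostIdx n → ℝ) :
    avoidProb i (B ∪ B') (C ∪ C') x v ≤ avoidProb i B C x v * avoidProb i B' C' x v := by
  set E : Finset (Fin n) → Finset (Fin n) → Set (CostIdx n → ℝ) := fun B C =>
    {w | ∀ j ∈ B, ∀ k ∈ C, x ≤ w (aIdx i j) + w (bIdx i k) + max (v (cIdx j k)) 0} with hE
  have hEm : ∀ B C, MeasurableSet (E B C) := fun B C => measurableSet_avoid_section i B C x v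
  set S : Finset (CostIdx n) := B'.image (aIdx i) ∪ C'.image (bIdx i) with hS
  have ha : ∀ j, aIdx i j ∈ S ↔ j ∈ B' := fun j => by simp [hS]
  have hb : ∀ k, bIdx i k ∈ S ↔ k ∈ C' := fun k => by simp [hS]
  have h1 : ∀ v w, S.piecewise w v ∈ E B C ↔ v ∈ E B C := fun v w => by
    simp only [hE, Set.mem_ofPred_eq, Finset.piecewise]
    refine forall₂_congr fun j hj => forall₂_congr fun k hk => ?_
    rw [if_neg (by rw [ha]; exact Finset.disjoint_left.1 hB hj),
      if_neg (by rw [hb]; exact Finset.disjoint_left.1 hC hk)]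
  have h2 : ∀ v w, S.piecewise w v ∈ E B' C' ↔ w ∈ E B' C' := fun v w => by
    simp only [hE, Set.mem_ofPred_eq, Finset.piecewise]
    refine forall₂_congr fun j hj => forall₂_congr fun k hk => ?_
    rw [if_pos (by rwa [ha]), if_pos (by rwa [hb])]
  have h3 := integral_mul_eq_of_piecewise (ν := unifMeasure) S
    (f := (E B C).indicator fun _ => (1 : ℝ)) (g := (E B' C').indicator fun _ => (1 : ℝ))
    (measurable_const.indicator (hEm _ _)) (measurable_const.indicator (hEm _ _))
    (fun v w => by simp only [Set.indicator, h1]) (fun v w => by simp only [Set.indicator, h2])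
  have h4 : (fun w => (E B C).indicator (fun _ => (1 : ℝ)) w *
      (E B' C').indicator (fun _ => (1 : ℝ)) w) =
      (E B C ∩ E B' C').indicator fun _ => (1 : ℝ) := by
    ext w
    by_cases h6 : w ∈ E B C <;> by_cases h7 : w ∈ E B' C' <;> simp [h6, h7]
  have h5 : ∀ s : Set (CostIdx n → ℝ), MeasurableSet s →
      ∫ w, s.indicator (fun _ => (1 : ℝ)) w ∂(costLaw n) = (costLaw n).real s := fun s hs => by
    rw [integral_indicator hs, setIntegral_const]; simp
  rw [h4, h5 _ (hEm _ _), h5 _ (hEm _ _), h5 _ ((hEm _ _).inter (hEm _ _))] at h3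
  change _ ≤ (costLaw n).real (E B C) * (costLaw n).real (E B' C')
  rw [← h3]
  refine measureReal_mono (fun w hw => ⟨?_, ?_⟩) (measure_ne_top _ _)
  · exact fun j hj k hk => hw j (Finset.mem_union_left _ hj) k (Finset.mem_union_left _ hk)
  · exact fun j hj k hk => hw j (Finset.mem_union_right _ hj) k (Finset.mem_union_right _ hk)

/-- A rectangle that contains `r` disjoint blocks of side `m'` is avoided with probability at most
the `r`-th power of the bound for the blocks. -/
theorem avoidProb_le_pow (i : Fin n) {m' : ℕ} {q x : ℝ} (v : CostIdx n → ℝ)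
    (hq : ∀ B C : Finset (Fin n), B.card = m' → C.card = m' → avoidProb i B C x v ≤ q) (r : ℕ) :
    ∀ B C : Finset (Fin n), r * m' ≤ B.card → r * m' ≤ C.card → avoidProb i B C x v ≤ q ^ r := by
  induction r with
  | zero => intro B C _ _; simpa using avoidProb_le_one i B C x v
  | succ r ih =>
    intro B C hB hC
    rw [Nat.succ_mul] at hB hC
    obtain ⟨B', hB', hB'c⟩ := Finset.exists_subset_card_eq (show m' ≤ B.card by omega)
    obtain ⟨C', hC', hC'c⟩ := Finset.exists_subset_card_eq (show m' ≤ C.card by omega)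
    have h1 := ih (B \ B') (C \ C') (by rw [Finset.card_sdiff_of_subset hB']; omega)
      (by rw [Finset.card_sdiff_of_subset hC']; omega)
    have h2 := avoidProb_union_le i (Finset.sdiff_disjoint (s := B') (t := B))
      (Finset.sdiff_disjoint (s := C') (t := C)) x v
    rw [Finset.sdiff_union_of_subset hB', Finset.sdiff_union_of_subset hC'] at h2
    refine h2.trans ?_
    rw [pow_succ]
    have h3 := hq B' C' hB'c hC'c
    exact mul_le_mul h1 h3 (avoidProb_nonneg _ _ _ _ _)
      ((avoidProb_nonneg _ _ _ _ _).trans h1)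

/-! ### The greedy algorithm -/

section Greedy

variable {W W' : Fin n → Fin n → Fin n → ℝ}

theorem greedyRun_zero_iff {B C : Finset (Fin n)} {T : Finset (Fin n × Fin n × Fin n)} :
    GreedyRun W 0 B C T ↔ B = Finset.univ ∧ C = Finset.univ ∧ T = ∅ := by
  constructor
  · intro h
    generalize hm : 0 = m at h
    cases h with
    | init => exact ⟨rfl, rfl, rfl⟩
    | step => omega
  · rintro ⟨rfl, rfl, rfl⟩; exact .init

theorem greedyRun_succ_iff (i : Fin n) {B C : Finset (Fin n)}
    {T : Finset (Fin n × Fin n × Fin n)} :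
    GreedyRun W (i + 1) B C T ↔ ∃ B' C' T' j k, GreedyRun W i B' C' T' ∧ j ∈ B' ∧ k ∈ C' ∧
      (∀ j' ∈ B', ∀ k' ∈ C', W i j k ≤ W i j' k') ∧
      B = B'.erase j ∧ C = C'.erase k ∧ T = insert (i, j, k) T' := by
  constructor
  · intro h
    generalize hm : (i : ℕ) + 1 = m at h
    cases h with
    | init => omega
    | step i' j k run hj hk hmin =>
      have : i' = i := Fin.ext (by omega)
      subst this
      exact ⟨_, _, _, j, k, run, hj, hk, hmin, rfl, rfl, rfl⟩
  · rintro ⟨B', C', T', j, k, run, hj, hk, hmin, rfl, rfl, rfl⟩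
    exact .step i j k run hj hk hmin

theorem GreedyRun.card {m : ℕ} {B C : Finset (Fin n)} {T : Finset (Fin n × Fin n × Fin n)}
    (h : GreedyRun W m B C T) : B.card + m = n ∧ C.card + m = n := by
  induction h with
  | init => simp
  | step i j k run hj hk hmin ih =>
    rw [Finset.card_erase_of_mem hj, Finset.card_erase_of_mem hk]
    have := Finset.card_pos.2 ⟨j, hj⟩
    have := Finset.card_pos.2 ⟨k, hk⟩
    omega

theorem GreedyRun.congr {m : ℕ} {B C : Finset (Fin n)} {T : Finset (Fin n × Fin n × Fin n)}
    (h : GreedyRun W m B C T) (hW : ∀ i : Fin n, (i : ℕ) < m → W i = W' i) :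
    GreedyRun W' m B C T := by
  induction h with
  | init => exact .init
  | step i j k run hj hk hmin ih =>
    refine .step i j k (ih fun i' hi' => hW i' (by omega)) hj hk ?_
    rw [← hW i (by omega)]
    exact hmin

theorem GreedyRun.unique (hW : ∀ i j k j' k', W i j k = W i j' k' → j = j' ∧ k = k') {m : ℕ}
    {B C : Finset (Fin n)} {T : Finset (Fin n × Fin n × Fin n)} (h : GreedyRun W m B C T) :
    ∀ {B' C' : Finset (Fin n)} {T' : Finset (Fin n × Fin n × Fin n)}, GreedyRun W m B' C' T' →
      B = B' ∧ C = C' := by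
  induction h with
  | init => intro B' C' T' h'; rw [greedyRun_zero_iff] at h'; exact ⟨h'.1.symm, h'.2.1.symm⟩
  | step i j k run hj hk hmin ih =>
    intro B' C' T' h'
    rw [greedyRun_succ_iff] at h'
    obtain ⟨B₁, C₁, T₁, j₁, k₁, run₁, hj₁, hk₁, hmin₁, rfl, rfl, rfl⟩ := h'
    obtain ⟨rfl, rfl⟩ := ih run₁
    obtain ⟨rfl, rfl⟩ := hW i j k j₁ k₁
      (le_antisymm (hmin j₁ hj₁ k₁ hk₁) (hmin₁ j hj k hk))
    exact ⟨rfl, rfl⟩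

theorem GreedyRun.exists_round {m : ℕ} {B C : Finset (Fin n)}
    {T : Finset (Fin n × Fin n × Fin n)} (h : GreedyRun W m B C T) (i : Fin n)
    (hi : (i : ℕ) < m) : ∃ B' C' T' j k, GreedyRun W i B' C' T' ∧ (i, j, k) ∈ T ∧
      ∀ j' ∈ B', ∀ k' ∈ C', W i j k ≤ W i j' k' := by
  induction h with
  | init => omega
  | @step B C T i' j k run hj hk hmin ih =>
    rcases Nat.lt_succ_iff_lt_or_eq.1 hi with h | h
    · obtain ⟨B', C', T', j', k', h1, h2, h3⟩ := ih h
      exact ⟨B', C', T', j', k', h1, Finset.mem_insert_of_mem h2, h3⟩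
    · have : i = i' := Fin.ext h
      subst this
      exact ⟨_, _, _, j, k, run, Finset.mem_insert_self _ _, hmin⟩

theorem IsGreedySolution.le {m : ℕ} {σ τ : Equiv.Perm (Fin n)} (h : IsGreedySolution W m σ τ)
    (i : Fin n) (hi : (i : ℕ) < m) : ∃ B C T, GreedyRun W i B C T ∧
      ∀ j ∈ B, ∀ k ∈ C, W i (σ i) (τ i) ≤ W i j k := by
  obtain ⟨B, C, T, run, hT⟩ := h
  obtain ⟨B', C', T', j, k, h1, h2, h3⟩ := run.exists_round i hi
  obtain ⟨rfl, rfl⟩ := hT i j k h2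
  exact ⟨B', C', T', h1, h3⟩

end Greedy

theorem measurableSet_greedyRun (m : ℕ) : ∀ (B C : Finset (Fin n))
    (T : Finset (Fin n × Fin n × Fin n)),
    MeasurableSet {v : CostIdx n → ℝ | GreedyRun (costAt v) m B C T} := by
  induction m with
  | zero => intro B C T; simp only [greedyRun_zero_iff]; exact MeasurableSet.const _
  | succ m ih =>
    intro B C T
    by_cases hm : m < n
    · have h := fun v : CostIdx n → ℝ => greedyRun_succ_iff (W := costAt v) ⟨m, hm⟩
        (B := B) (C := C) (T := T)
      simp only at h
      simp only [h]
      refine measurableSet_setOfPred.2 (Measurable.exists fun B' => Measurable.exists fun C' =>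
        Measurable.exists fun T' => Measurable.exists fun j => Measurable.exists fun k =>
        (measurableSet_setOfPred.1 (ih B' C' T')).and (measurable_const.and
          (measurable_const.and (Measurable.and ?_ measurable_const))))
      simp only [costAt]
      measurability
    · have : {v : CostIdx n → ℝ | GreedyRun (costAt v) (m + 1) B C T} = ∅ := by
        ext v
        simp only [Set.mem_ofPred_eq, Set.mem_empty_iff_false, iff_false]
        intro h
        have := h.card
        omega
      rw [this]
      exact MeasurableSet.empty

theorem costLaw_ae_of_volume {p : (CostIdx n → ℝ) → Prop} (h : ∀ᵐ v, p v) :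
    ∀ᵐ v ∂(costLaw n), p v := by
  have : costLaw n = (volume : Measure (CostIdx n → ℝ)).restrict
      (Set.univ.pi fun _ => Set.Icc 0 1) := by
    rw [volume_pi, Measure.restrict_pi_pi]
  rw [this]
  exact ae_restrict_of_ae h

/-- Ties have probability `0`, as they lie in hyperplanes. -/
theorem costAt_ae_injective : ∀ᵐ v ∂(costLaw n), ∀ i j k j' k',
    costAt v i j k = costAt v i j' k' → j = j' ∧ k = k' := by
  refine costLaw_ae_of_volume ?_
  simp only [ae_all_iff]
  intro i j k j' k'
  by_cases h : j = j' ∧ k = k'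
  · exact ae_of_all _ fun _ _ => h
  let π : CostIdx n → ((CostIdx n → ℝ) →ₗ[ℝ] ℝ) := fun s => LinearMap.proj s
  let φ : (CostIdx n → ℝ) →ₗ[ℝ] ℝ :=
    π (aIdx i j) + π (bIdx i k) + π (cIdx j k) - (π (aIdx i j') + π (bIdx i k') + π (cIdx j' k'))
  have hφ : φ.ker ≠ ⊤ := by
    intro h0
    rw [LinearMap.ker_eq_top] at h0
    have h1 := LinearMap.congr_fun h0 (Pi.single (cIdx j k) 1)
    have h3 : ¬(j' = j ∧ k' = k) := fun h3 => h ⟨h3.1.symm, h3.2.symm⟩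
    simp [φ, π, h3] at h1
  have hz := Measure.addHaar_submodule (volume : Measure (CostIdx n → ℝ)) φ.ker hφ
  filter_upwards [measure_eq_zero_iff_ae_notMem.1 hz] with v hv heq
  exact absurd (by simp only [SetLike.mem_coe, LinearMap.mem_ker]; simpa [φ, π, costAt, sub_eq_zero] using heq) hv

/-- The event that the costs `c` give some pair `B`, `C` of size `m` an avoidance probability
above `q`. -/
def exceptional (i : Fin n) (m : ℕ) (x q : ℝ) : Set (CostIdx n → ℝ) :=
  {v | ∃ B C : Finset (Fin n), B.card = m ∧ C.card = m ∧ q < avoidProb i B C x v}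

theorem measurableSet_exceptional (i : Fin n) (m : ℕ) (x q : ℝ) :
    MeasurableSet (exceptional i m x q) :=
  measurableSet_setOfPred.2 (Measurable.exists fun _ => Measurable.exists fun _ =>
    measurable_const.and (measurable_const.and (measurableSet_setOfPred.1
      (measurableSet_lt measurable_const (measurable_avoidProb _ _ _ _)))))

theorem measure_exceptional_le (i : Fin n) (m : ℕ) (x q : ℝ) {b : ℝ} (hb : 0 ≤ b)
    (h : ∀ B C : Finset (Fin n), B.card = m → C.card = m →
      (costLaw n).real {v | q < avoidProb i B C x v} ≤ b) :
    (costLaw n).real (exceptional i m x q) ≤ (n : ℝ) ^ (2 * m) * b := by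
  set R : Finset (Finset (Fin n) × Finset (Fin n)) :=
    (Finset.univ.powersetCard m) ×ˢ (Finset.univ.powersetCard m) with hR
  calc (costLaw n).real (exceptional i m x q)
      ≤ (costLaw n).real (⋃ p ∈ R, {v | q < avoidProb i p.1 p.2 x v}) := by
        refine measureReal_mono ?_ (measure_ne_top _ _)
        rintro v ⟨B, C, hB, hC, hq⟩
        refine Set.mem_iUnion₂.2 ⟨(B, C), ?_, hq⟩
        simp [hR, hB, hC]
    _ ≤ ∑ p ∈ R, (costLaw n).real {v | q < avoidProb i p.1 p.2 x v} :=
        measureReal_biUnion_finset_le _ _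
    _ ≤ ∑ p ∈ R, b := by
        refine Finset.sum_le_sum fun p hp => ?_
        simp only [hR, Finset.mem_product, Finset.mem_powersetCard_univ] at hp
        exact h _ _ hp.1 hp.2
    _ = ((n.choose m : ℕ) : ℝ) ^ 2 * b := by
        simp [hR, sq]
    _ ≤ ((n : ℝ) ^ m) ^ 2 * b := by
        gcongr
        exact_mod_cast Nat.choose_le_pow n m
    _ = (n : ℝ) ^ (2 * m) * b := by rw [← pow_mul, mul_comm m]

/-- The event that in round `i` all available triples cost at least `x`. -/
def roundGe (i : Fin n) (x : ℝ) : Set (CostIdx n → ℝ) :=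
  {v | ∃ B C T, GreedyRun (costAt v) i B C T ∧ ∀ j ∈ B, ∀ k ∈ C, x ≤ costAt v i j k}

/-- The cost of round `i` is at least `x` with probability at most `q`, up to the probability that
some pair `B`, `C` of the right size has avoidance probability above `q`. Row `i` is independent
of the sets `B`, `C` that the algorithm meets in round `i`; the union over all `B`, `C` takes care
of their dependence on the costs `c`. -/
theorem measure_roundGe_le (i : Fin n) {m : ℕ} (hm : m + i = n) {q : ℝ} (hq : 0 ≤ q) (x : ℝ) :
    (costLaw n).real (roundGe i x) ≤ q + (costLaw n).real (exceptional i m x q) := by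
  set R : Finset (Finset (Fin n) × Finset (Fin n)) :=
    (Finset.univ.powersetCard m) ×ˢ (Finset.univ.powersetCard m) with hR
  set A : Finset (Fin n) × Finset (Fin n) → Set (CostIdx n → ℝ) := fun p =>
    {v | ∃ T, GreedyRun (costAt v) i p.1 p.2 T} with hA
  have hAm : ∀ p, MeasurableSet (A p) := fun p =>
    measurableSet_setOfPred.2 (Measurable.exists fun T =>
      measurableSet_setOfPred.1 (measurableSet_greedyRun _ _ _ T))
  have hAi : ∀ p v w, (rowIdx i).piecewise w v ∈ A p ↔ v ∈ A p := by
    intro p v w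
    have hrow : ∀ i' : Fin n, (i' : ℕ) < i →
        costAt ((rowIdx i).piecewise w v) i' = costAt v i' := by
      intro i' hi'
      have hne : i' ≠ i := fun h => by rw [h] at hi'; omega
      funext j k
      simp [costAt, Finset.piecewise, aIdx_notMem_rowIdx hne, bIdx_notMem_rowIdx hne,
        cIdx_notMem_rowIdx]
    exact exists_congr fun T => ⟨fun h => h.congr hrow, fun h => h.congr fun i' h' =>
      (hrow i' h').symm⟩
  have hF : ∀ p : Finset (Fin n) × Finset (Fin n),
      Integrable (fun v => avoidProb i p.1 p.2 x v) (costLaw n) := fun p =>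
    Integrable.of_bound (measurable_avoidProb _ _ _ _).aestronglyMeasurable 1
      (ae_of_all _ fun v => abs_avoidProb_le _ _ _ _ _)
  have hQm := measurableSet_exceptional i m x q
  have hpt : ∀ᵐ v ∂(costLaw n), ∑ p ∈ R, (A p).indicator (avoidProb i p.1 p.2 x) v ≤
      q + (exceptional i m x q).indicator (fun _ => (1 : ℝ)) v := by
    filter_upwards [costAt_ae_injective] with v hv
    have hi0 : 0 ≤ (exceptional i m x q).indicator (fun _ => (1 : ℝ)) v :=
      Set.indicator_nonneg (fun _ _ => zero_le_one) v
    by_cases hex : ∃ p ∈ R, v ∈ A p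
    · obtain ⟨p, hp, hpA⟩ := hex
      obtain ⟨T, hT⟩ := hpA
      rw [Finset.sum_eq_single_of_mem p hp]
      · rw [Set.indicator_of_mem (show v ∈ A p from ⟨T, hT⟩)]
        by_cases hq' : q < avoidProb i p.1 p.2 x v
        · simp only [hR, Finset.mem_product, Finset.mem_powersetCard_univ] at hp
          rw [Set.indicator_of_mem (show v ∈ exceptional i m x q from
            ⟨p.1, p.2, hp.1, hp.2, hq'⟩)]
          linarith [avoidProb_le_one i p.1 p.2 x v]
        · linarith
      · rintro p' _ hne
        refine Set.indicator_of_notMem ?_ _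
        rintro ⟨T', hT'⟩
        obtain ⟨h3, h4⟩ := GreedyRun.unique hv hT' hT
        exact hne (Prod.ext h3 h4)
    · push Not at hex
      rw [Finset.sum_eq_zero fun p hp => Set.indicator_of_notMem (hex p hp) _]
      linarith
  calc (costLaw n).real (roundGe i x)
      ≤ (costLaw n).real (⋃ p ∈ R, A p ∩
          {v | ∀ j ∈ p.1, ∀ k ∈ p.2, x ≤ costAt v i j k}) := by
        refine measureReal_mono ?_ (measure_ne_top _ _)
        rintro v ⟨B, C, T, hT, hx⟩
        have := hT.card
        refine Set.mem_iUnion₂.2 ⟨(B, C), ?_, ⟨T, hT⟩, hx⟩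
        simp only [hR, Finset.mem_product, Finset.mem_powersetCard_univ]
        omega
    _ ≤ ∑ p ∈ R, (costLaw n).real (A p ∩ {v | ∀ j ∈ p.1, ∀ k ∈ p.2, x ≤ costAt v i j k}) :=
        measureReal_biUnion_finset_le _ _
    _ = ∫ v, ∑ p ∈ R, (A p).indicator (avoidProb i p.1 p.2 x) v ∂(costLaw n) := by
        rw [integral_finsetSum _ fun p _ => (hF p).indicator (hAm p)]
        exact Finset.sum_congr rfl fun p _ =>
          measureReal_inter_avoid i p.1 p.2 x (hAm p) (hAi p)
    _ ≤ ∫ v, q + (exceptional i m x q).indicator (fun _ => (1 : ℝ)) v ∂(costLaw n) :=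
        integral_mono_ae (integrable_finsetSum _ fun p _ => (hF p).indicator (hAm p))
          ((integrable_const _).add ((integrable_const _).indicator hQm)) hpt
    _ = q + (costLaw n).real (exceptional i m x q) := by
        rw [integral_add (integrable_const _) ((integrable_const _).indicator hQm),
          integral_indicator hQm, setIntegral_const]
        simp

/-! ### Asymptotics of a round -/

theorem eventually_cubeRoot_conditions (U d : ℝ) (hU : 1 ≤ U) (hd : 0 < d) :
    ∀ᶠ t : ℝ in Filter.atTop, 1 ≤ t ∧ U ≤ t ^ 2 ∧ 3 * U ^ 5 / t ≤ d ∧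
      72 * t ^ 3 * Real.log t ≤ d ^ 2 * t ^ 4 / (4 * U ^ 5) := by
  have h1 : ∀ᶠ t : ℝ in Filter.atTop, ‖Real.log t‖ ≤ d ^ 2 / (288 * U ^ 5) * ‖id t‖ :=
    Real.isLittleO_log_id_atTop.bound (by positivity)
  filter_upwards [h1, Filter.eventually_ge_atTop 1, Filter.eventually_ge_atTop U,
    Filter.eventually_ge_atTop (3 * U ^ 5 / d)] with t h1 h2 h3 h4
  have ht : 0 < t := by linarith
  refine ⟨h2, by nlinarith, ?_, ?_⟩
  · rw [div_le_iff₀ ht]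
    rw [div_le_iff₀ hd] at h4
    linarith
  · have h5 : Real.log t ≤ d ^ 2 / (288 * U ^ 5) * t := by
      have := (le_abs_self (Real.log t)).trans h1
      rwa [id, Real.norm_eq_abs, abs_of_pos ht] at this
    calc 72 * t ^ 3 * Real.log t ≤ 72 * t ^ 3 * (d ^ 2 / (288 * U ^ 5) * t) := by gcongr
      _ = _ := by field_simp; ring

theorem cubeRoot_pow_three (m : ℕ) : ((m : ℝ) ^ (1 / 3 : ℝ)) ^ 3 = m := by
  rw [← Real.rpow_natCast, ← Real.rpow_mul (Nat.cast_nonneg m)]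
  norm_num

theorem rpow_neg_two_thirds (m : ℕ) :
    (m : ℝ) ^ (-(2 / 3) : ℝ) = (((m : ℝ) ^ (1 / 3 : ℝ)) ^ 2)⁻¹ := by
  rw [← Real.rpow_natCast, ← Real.rpow_mul (Nat.cast_nonneg m), ← Real.rpow_neg
    (Nat.cast_nonneg m)]
  norm_num

theorem tendsto_cubeRoot : Filter.Tendsto (fun m : ℕ => (m : ℝ) ^ (1 / 3 : ℝ)) Filter.atTop
    Filter.atTop :=
  (tendsto_rpow_atTop (by norm_num)).comp tendsto_natCast_atTop_atTop

/-- On the scale `m ^ (-2/3)`, the avoidance probability of any `m × m` rectangle exceeds its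
Poisson limit by `2 * d` with a probability so small that a union bound over all rectangles is
affordable. -/
theorem measure_exceptional_le_inv_sq {U d : ℝ} (hU : 1 ≤ U) (hd : 0 < d) (hd1 : d ≤ 1) :
    ∃ M : ℕ, ∀ m, M ≤ m → ∀ n, m ≤ n → n ≤ m ^ 8 → ∀ (i : Fin n) (u : ℝ), 0 ≤ u → u ≤ U →
      (costLaw n).real (exceptional i m (u * (m : ℝ) ^ (-(2 / 3) : ℝ))
        (Real.exp (-(u ^ 3 / 6)) + 2 * d)) ≤ ((m : ℝ) ^ 2)⁻¹ := by
  obtain ⟨M, hM⟩ := Filter.eventually_atTop.1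
    (tendsto_cubeRoot.eventually (eventually_cubeRoot_conditions U d hU hd))
  refine ⟨max M 2, fun m hm n hmn hn i u hu0 huU => ?_⟩
  obtain ⟨ht1, hUt, hErr, hlog⟩ := hM m (le_trans (le_max_left _ _) hm)
  have hm2 : 2 ≤ m := le_trans (le_max_right _ _) hm
  have hm1 : 1 ≤ m := by omega
  rw [rpow_neg_two_thirds]
  set t : ℝ := (m : ℝ) ^ (1 / 3 : ℝ) with ht
  have htm : (m : ℝ) = t ^ 3 := (cubeRoot_pow_three m).symm
  have ht0 : 0 < t := by linarith
  have hm0 : (0 : ℝ) < m := by exact_mod_cast hm1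
  have hn1 : (1 : ℝ) ≤ n := by exact_mod_cast hm1.trans hmn
  set x : ℝ := u * (t ^ 2)⁻¹ with hx
  set X : ℝ := U * (t ^ 2)⁻¹ with hX
  have hx0 : 0 ≤ x := by positivity
  have hxX : x ≤ X := by rw [hx, hX]; gcongr
  have hX0 : 0 < X := by positivity
  have hX1 : X ≤ 1 := by rw [hX, ← div_eq_mul_inv]; exact (div_le_one (by positivity)).2 hUt
  have hU3 : 1 ≤ U ^ 3 := one_le_pow₀ hU
  have key : ∀ B C : Finset (Fin n), B.card = m → C.card = m →
      (costLaw n).real {v | Real.exp (-(u ^ 3 / 6)) + 2 * d < avoidProb i B C x v} ≤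
        ((n : ℝ) ^ (3 * m))⁻¹ := by
    intro B C hB hC
    have hdX : d ≤ 2 * (m : ℝ) ^ 2 * X ^ 3 := by
      have : 2 * (m : ℝ) ^ 2 * X ^ 3 = 2 * U ^ 3 := by
        rw [htm, hX]; field_simp
      rw [this]; linarith
    have h1 := measure_avoidProb_ge_le i hm1 hB hC hx0 hxX hX0 hX1 hd.le hdX
    have h2 := integral_avoidProb_le i hB hC hx0 (hxX.trans hX1)
    have e1 : (m : ℝ) ^ 2 * (x ^ 3 / 6) = u ^ 3 / 6 := by
      rw [htm, hx]; field_simp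
    have e2 : 2 * (m : ℝ) ^ 3 * x ^ 5 + (m : ℝ) ^ 2 * x ^ 4 ≤ d := by
      have : 2 * (m : ℝ) ^ 3 * x ^ 5 + (m : ℝ) ^ 2 * x ^ 4 = 2 * u ^ 5 / t + u ^ 4 / t ^ 2 := by
        rw [htm, hx]; field_simp
      rw [this]
      have h3 : u ^ 5 ≤ U ^ 5 := pow_le_pow_left₀ hu0 huU 5
      have h4 : u ^ 4 ≤ U ^ 5 := (pow_le_pow_left₀ hu0 huU 4).trans
        (pow_le_pow_right₀ hU (by norm_num))
      have h5 : u ^ 4 / t ^ 2 ≤ U ^ 5 / t := by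
        gcongr
        nlinarith
      have h6 : 2 * u ^ 5 / t ≤ 2 * U ^ 5 / t := by gcongr
      have h7 : 2 * U ^ 5 / t + U ^ 5 / t = 3 * U ^ 5 / t := by ring
      linarith
    have e3 : d ^ 2 / (4 * (m : ℝ) ^ 2 * X ^ 5) = d ^ 2 * t ^ 4 / (4 * U ^ 5) := by
      rw [htm, hX]; field_simp
    rw [e1] at h2
    rw [e3] at h1
    refine le_trans (measureReal_mono ?_ (measure_ne_top _ _)) (h1.trans ?_)
    · intro v hv
      simp only [Set.mem_ofPred_eq] at hv ⊢
      linarith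
    · rw [Real.exp_neg]
      refine inv_anti₀ (by positivity) ?_
      have h3 : (n : ℝ) ≤ (m : ℝ) ^ 8 := by exact_mod_cast hn
      have hlogm : Real.log m = 3 * Real.log t := by rw [htm, Real.log_pow]; norm_num
      calc (n : ℝ) ^ (3 * m) ≤ ((m : ℝ) ^ 8) ^ (3 * m) := by gcongr
        _ = Real.exp (24 * m * Real.log m) := by
            rw [← pow_mul, ← Real.exp_log (pow_pos hm0 _), Real.log_pow]
            push_cast; ring_nf
        _ ≤ _ := by
            refine Real.exp_le_exp.2 (le_trans (le_of_eq ?_) hlog)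
            rw [hlogm, htm]; ring
  refine (measure_exceptional_le i m x _ (by positivity) key).trans ?_
  have h4 : (n : ℝ) ^ (2 * m) * ((n : ℝ) ^ (3 * m))⁻¹ = ((n : ℝ) ^ m)⁻¹ := by
    have : (n : ℝ) ^ (3 * m) = (n : ℝ) ^ (2 * m) * (n : ℝ) ^ m := by rw [← pow_add]; ring_nf
    rw [this]
    field_simp
  rw [h4]
  refine inv_anti₀ (by positivity) ?_
  calc (m : ℝ) ^ 2 ≤ (n : ℝ) ^ 2 := by gcongr
    _ ≤ (n : ℝ) ^ m := pow_le_pow_right₀ hn1 hm2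

theorem roundGe_anti (i : Fin n) : Antitone (roundGe i) := by
  rintro x y hxy v ⟨B, C, T, h1, h2⟩
  exact ⟨B, C, T, h1, fun j hj k hk => hxy.trans (h2 j hj k hk)⟩

theorem measure_roundGe_anti (i : Fin n) :
    Antitone fun x => (costLaw n).real (roundGe i x) := fun _ _ h =>
  measureReal_mono (roundGe_anti i h) (measure_ne_top _ _)

theorem measure_roundGe_main {U d : ℝ} (hU : 1 ≤ U) (hd : 0 < d) (hd1 : d ≤ 1) :
    ∃ M : ℕ, ∀ m, M ≤ m → ∀ n, n ≤ m ^ 8 → ∀ i : Fin n, m + i = n → ∀ u : ℝ, 0 ≤ u → u ≤ U →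
      (costLaw n).real (roundGe i (u * (m : ℝ) ^ (-(2 / 3) : ℝ))) ≤
        Real.exp (-(u ^ 3 / 6)) + 2 * d + ((m : ℝ) ^ 2)⁻¹ := by
  obtain ⟨M, hM⟩ := measure_exceptional_le_inv_sq hU hd hd1
  refine ⟨M, fun m hm n hn i hi u hu0 huU => ?_⟩
  have h1 := measure_roundGe_le i hi (q := Real.exp (-(u ^ 3 / 6)) + 2 * d)
    (by positivity) (u * (m : ℝ) ^ (-(2 / 3) : ℝ))
  linarith [hM m hm n (by omega) hn i u hu0 huU]

theorem sq_le_two_mul_two_pow (r : ℕ) : r ^ 2 ≤ 2 * 2 ^ r := by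
  rcases lt_or_ge r 4 with h | h
  · interval_cases r <;> norm_num
  · induction r, h using Nat.le_induction with
    | base => norm_num
    | succ r hr ih => rw [pow_succ 2 r]; nlinarith

/-- The tail of the cost of a round. An `m × m` rectangle contains about `u ^ (3/2)` disjoint
blocks each of which is avoided with probability at most `1 / 2`; this gives a decay faster than
the power of `u` stated here. -/
theorem measure_roundGe_tail : ∃ M : ℕ, ∀ m, M ≤ m → ∀ n, n ≤ m ^ 4 → ∀ i : Fin n, m + i = n →
    ∀ u : ℝ, 0 < u → u ^ 3 ≤ m →
      (costLaw n).real (roundGe i (u * (m : ℝ) ^ (-(2 / 3) : ℝ))) ≤ 512 / u ^ 3 := by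
  obtain ⟨M, hM⟩ := measure_exceptional_le_inv_sq (U := 2) (d := 1 / 20) (by norm_num)
    (by norm_num) (by norm_num)
  refine ⟨M ^ 2 + 1, fun m hm n hn i hi u hu0 hum => ?_⟩
  have hu3 : 0 < u ^ 3 := by positivity
  set r := Nat.sqrt ⌊u ^ 3 / 32⌋₊ with hr
  have hr1 : 32 * (r : ℝ) ^ 2 ≤ u ^ 3 := by
    have h1 : r ^ 2 ≤ ⌊u ^ 3 / 32⌋₊ := Nat.sqrt_le' _
    have h2 : ((r ^ 2 : ℕ) : ℝ) ≤ u ^ 3 / 32 :=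
      (Nat.cast_le.2 h1).trans (Nat.floor_le (by positivity))
    push_cast at h2
    linarith
  have hr2 : u ^ 3 < 32 * ((r : ℝ) + 1) ^ 2 := by
    have h1 : ⌊u ^ 3 / 32⌋₊ < (r + 1) ^ 2 := Nat.lt_succ_sqrt' _
    have h2 := (Nat.floor_lt (by positivity)).1 h1
    push_cast at h2
    linarith
  rcases Nat.eq_zero_or_pos r with hr0 | hr0
  · rw [hr0] at hr2
    refine measureReal_le_one.trans ?_
    rw [le_div_iff₀ hu3]
    norm_num at hr2
    linarith
  have hrR : (1 : ℝ) ≤ r := by exact_mod_cast hr0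
  have hrm : 32 * r ^ 2 ≤ m := by
    have : 32 * (r : ℝ) ^ 2 ≤ m := hr1.trans hum
    exact_mod_cast this
  set m' := m / r with hm'
  have hm'1 : m < (m' + 1) * r := by
    have := Nat.lt_div_mul_add hr0 (a := m)
    rw [← hm'] at this
    nlinarith
  have hm'2 : r * m' ≤ m := Nat.mul_div_le m r
  have hm'0 : 1 ≤ m' := Nat.div_pos (by nlinarith) hr0
  have hm'3 : m ≤ m' ^ 2 := by
    by_contra hcon
    push Not at hcon
    have h1 : m < 2 * m' * r := lt_of_lt_of_le hm'1 (by nlinarith)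
    have h2 : m * m < (2 * m' * r) * (2 * m' * r) := Nat.mul_lt_mul'' h1 h1
    have h3 : (2 * m' * r) * (2 * m' * r) = 4 * m' ^ 2 * r ^ 2 := by ring
    have h4 : 4 * m' ^ 2 * r ^ 2 ≤ 4 * m * r ^ 2 := by gcongr
    have h5 : 4 * m * r ^ 2 ≤ m * m := by nlinarith
    omega
  have hMm' : M ≤ m' := by
    by_contra hcon
    push Not at hcon
    have : m' ^ 2 ≤ M ^ 2 := Nat.pow_le_pow_left hcon.le 2
    omega
  have hm'n : m' ≤ n := (Nat.div_le_self m r).trans (by omega)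
  have hn8 : n ≤ m' ^ 8 := by
    calc n ≤ m ^ 4 := hn
      _ ≤ (m' ^ 2) ^ 4 := Nat.pow_le_pow_left hm'3 4
      _ = m' ^ 8 := by ring
  have h1 := hM m' hMm' n hm'n hn8 i 2 (by norm_num) le_rfl
  have hhalf : Real.exp (-(2 ^ 3 / 6)) + 2 * (1 / 20) ≤ 1 / 2 := by
    have h2 := Real.quadratic_le_exp_of_nonneg (x := 2 ^ 3 / 6) (by norm_num)
    have h3 : (Real.exp (2 ^ 3 / 6))⁻¹ ≤ (5 / 2)⁻¹ :=
      inv_anti₀ (by norm_num) (le_trans (by norm_num) h2)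
    rw [Real.exp_neg]
    norm_num at h3 ⊢
    linarith
  -- the threshold for the blocks is below the threshold for the whole rectangle
  have hx : 2 * (m' : ℝ) ^ (-(2 / 3) : ℝ) ≤ u * (m : ℝ) ^ (-(2 / 3) : ℝ) := by
    rw [rpow_neg_two_thirds, rpow_neg_two_thirds]
    set s : ℝ := (m' : ℝ) ^ (1 / 3 : ℝ)
    set t : ℝ := (m : ℝ) ^ (1 / 3 : ℝ)
    have hs : (m' : ℝ) = s ^ 3 := (cubeRoot_pow_three m').symm
    have ht : (m : ℝ) = t ^ 3 := (cubeRoot_pow_three m).symm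
    have hs0 : 0 < s := Real.rpow_pos_of_pos (by exact_mod_cast hm'0) _
    have ht0 : 0 < t := Real.rpow_pos_of_pos (by exact_mod_cast (show 0 < m by omega)) _
    rw [← div_eq_mul_inv, ← div_eq_mul_inv, div_le_div_iff₀ (by positivity) (by positivity)]
    refine le_of_pow_le_pow_left₀ (n := 3) (by norm_num) (by positivity) ?_
    have h3 : (m : ℝ) ≤ 2 * r * m' := by
      have : m ≤ 2 * r * m' := by nlinarith
      exact_mod_cast this
    calc ((2 : ℝ) * t ^ 2) ^ 3 = 8 * (m : ℝ) ^ 2 := by rw [ht]; ring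
      _ ≤ 8 * (2 * (r : ℝ) * m') ^ 2 := by gcongr
      _ = 32 * (r : ℝ) ^ 2 * (m' : ℝ) ^ 2 := by ring
      _ ≤ u ^ 3 * (m' : ℝ) ^ 2 := by gcongr
      _ = (u * s ^ 2) ^ 3 := by rw [hs]; ring
  have hsub : exceptional i m (u * (m : ℝ) ^ (-(2 / 3) : ℝ)) ((1 / 2) ^ r) ⊆
      exceptional i m' (2 * (m' : ℝ) ^ (-(2 / 3) : ℝ))
        (Real.exp (-(2 ^ 3 / 6)) + 2 * (1 / 20)) := by
    rintro v ⟨B, C, hB, hC, hq⟩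
    by_contra hcon
    refine absurd hq (not_lt.2 ?_)
    refine avoidProb_le_pow i (m' := m') v (fun B' C' hB' hC' => ?_) r B C (by omega) (by omega)
    by_contra h2
    refine hcon ⟨B', C', hB', hC', ?_⟩
    push Not at h2
    refine lt_of_le_of_lt hhalf (h2.trans_le ?_)
    exact measureReal_mono (fun w hw j hj k hk => hx.trans (hw j hj k hk)) (measure_ne_top _ _)
  have h2 := measure_roundGe_le i hi (q := (1 / 2 : ℝ) ^ r) (by positivity)
    (u * (m : ℝ) ^ (-(2 / 3) : ℝ))
  have h3 := (measureReal_mono (μ := costLaw n) hsub (measure_ne_top _ _)).trans h1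
  have h4 : (1 / 2 : ℝ) ^ r ≤ 256 / u ^ 3 := by
    have h5 : (r : ℝ) ^ 2 ≤ 2 * 2 ^ r := by exact_mod_cast sq_le_two_mul_two_pow r
    rw [one_div, inv_pow, le_div_iff₀ hu3, inv_mul_le_iff₀ (by positivity)]
    nlinarith
  have h5 : ((m' : ℝ) ^ 2)⁻¹ ≤ 256 / u ^ 3 := by
    have h6 : u ^ 3 ≤ (m' : ℝ) ^ 2 := hum.trans (by exact_mod_cast hm'3)
    calc ((m' : ℝ) ^ 2)⁻¹ ≤ (u ^ 3)⁻¹ := inv_anti₀ hu3 h6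
      _ ≤ 256 / u ^ 3 := by rw [inv_eq_one_div]; gcongr; norm_num
  calc _ ≤ _ := h2
    _ ≤ 256 / u ^ 3 + 256 / u ^ 3 := by linarith
    _ = 512 / u ^ 3 := by ring

/-! ### Expected costs of rounds and of row minima -/

/-- The truncated integral of the limiting tail `exp (-u ^ 3 / 6)` of a minimum over an `m × m`
rectangle, on the scale `m ^ (-2/3)`. -/
def tailIntegral (U : ℝ) : ℝ := ∫ u in (0 : ℝ)..U, Real.exp (-(u ^ 3 / 6))

theorem half_le_tailIntegral {U : ℝ} (hU : 1 ≤ U) : 1 / 2 ≤ tailIntegral U := by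
  have hc : ∀ a b : ℝ, IntervalIntegrable (fun u : ℝ => Real.exp (-(u ^ 3 / 6))) volume a b :=
    fun a b => Continuous.intervalIntegrable (by fun_prop) a b
  unfold tailIntegral
  rw [← intervalIntegral.integral_add_adjacent_intervals (hc 0 1) (hc 1 U)]
  have h1 : 0 ≤ ∫ u in (1 : ℝ)..U, Real.exp (-(u ^ 3 / 6)) :=
    intervalIntegral.integral_nonneg hU fun u _ => (Real.exp_pos _).le
  have h2 : ∫ u in (0 : ℝ)..1, (1 / 2 : ℝ) ≤ ∫ u in (0 : ℝ)..1, Real.exp (-(u ^ 3 / 6)) := by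
    refine intervalIntegral.integral_mono_on zero_le_one (by simp) (hc 0 1) fun u hu => ?_
    have h3 : u ^ 3 ≤ 1 := pow_le_one₀ hu.1 hu.2
    linarith [Real.add_one_le_exp (-(u ^ 3 / 6))]
  simp at h2
  norm_num
  linarith

theorem integral_div_cube {U t : ℝ} (hU : 0 < U) (ht : U ≤ t) (c : ℝ) :
    ∫ u in U..t, c / u ^ 3 = c / 2 * (1 / U ^ 2 - 1 / t ^ 2) := by
  have hpos : ∀ u ∈ Set.uIcc U t, u ≠ 0 := fun u hu => by
    rw [Set.uIcc_of_le ht] at hu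
    linarith [hu.1]
  rw [intervalIntegral.integral_eq_sub_of_hasDerivAt (f := fun u => -(c / 2) * (u ^ 2)⁻¹)
    (f' := fun u => c / u ^ 3)]
  · ring
  · intro u hu
    have h0 := hpos u hu
    have h1 := ((hasDerivAt_pow 2 u).inv (pow_ne_zero 2 h0)).const_mul (-(c / 2))
    refine h1.congr_deriv ?_
    norm_num
    field_simp
  · refine ContinuousOn.intervalIntegrable fun u hu => ContinuousAt.continuousWithinAt ?_
    exact continuousAt_const.div (by fun_prop) (pow_ne_zero 3 (hpos u hu))

/-- The mean cost of a round of greedy with `m` indices left. -/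
theorem integral_roundGe_le {U θ : ℝ} (hU : 1 ≤ U) (hθ : 0 < θ) :
    ∃ M : ℕ, ∀ m, M ≤ m → ∀ n, n ≤ m ^ 4 → ∀ i : Fin n, m + i = n →
      ∫ x in (0 : ℝ)..3, (costLaw n).real (roundGe i x) ≤
        (tailIntegral U + 256 / U ^ 2 + θ) * (m : ℝ) ^ (-(2 / 3) : ℝ) := by
  have hU0 : 0 < U := by linarith
  set d := min 1 (θ / (6 * U)) with hd
  have hd0 : 0 < d := lt_min one_pos (by positivity)
  have hdU : 2 * d * U ≤ θ / 3 := by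
    have h1 : d ≤ θ / (6 * U) := min_le_right _ _
    have h2 : d * (6 * U) ≤ θ := (le_div_iff₀ (by positivity)).1 h1
    linarith
  obtain ⟨M₁, hM₁⟩ := measure_roundGe_main hU hd0 (min_le_left _ _)
  obtain ⟨M₂, hM₂⟩ := measure_roundGe_tail
  obtain ⟨M₃, hM₃⟩ := Filter.eventually_atTop.1 (tendsto_cubeRoot.eventually
    ((Filter.eventually_ge_atTop U).and ((Filter.eventually_ge_atTop (3 * U / θ)).and
      (Filter.eventually_ge_atTop (3 * 1536 / θ)))))
  refine ⟨max (max M₁ M₂) M₃, fun m hm n hn i hi => ?_⟩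
  simp only [max_le_iff] at hm
  obtain ⟨⟨hm1, hm2⟩, hm3⟩ := hm
  obtain ⟨htU, ht1, ht2⟩ := hM₃ m hm3
  have hn8 : n ≤ m ^ 8 := hn.trans (by
    rcases Nat.eq_zero_or_pos m with h | h
    · simp [h]
    · exact Nat.pow_le_pow_right h (by norm_num))
  have hmain := hM₁ m hm1 n hn8 i hi
  have htail := hM₂ m hm2 n hn i hi
  rw [rpow_neg_two_thirds] at hmain htail ⊢
  set t : ℝ := (m : ℝ) ^ (1 / 3 : ℝ) with ht
  have htm : (m : ℝ) = t ^ 3 := (cubeRoot_pow_three m).symm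
  rw [htm] at hmain htail
  have ht0 : 0 < t := by linarith
  have ht1' : 1 ≤ t := hU.trans htU
  set s : ℝ := (t ^ 2)⁻¹ with hs
  have hs0 : 0 < s := by positivity
  set g : ℝ → ℝ := fun u => (costLaw n).real (roundGe i (u * s)) with hg
  have hganti : Antitone g := fun u w h => measure_roundGe_anti i (by gcongr)
  have hgi : ∀ a b : ℝ, IntervalIntegrable g volume a b := fun a b => hganti.intervalIntegrable
  have hscale : ∫ x in (0 : ℝ)..3, (costLaw n).real (roundGe i x) =
      s * ∫ u in (0 : ℝ)..3 * t ^ 2, g u := by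
    have h1 := intervalIntegral.integral_comp_mul_right (a := 0) (b := 3 * t ^ 2)
      (fun x => (costLaw n).real (roundGe i x)) hs0.ne'
    simp only [hg]
    rw [h1, zero_mul, smul_eq_mul, mul_inv_cancel_left₀ hs0.ne']
    congr 1
    rw [hs]; field_simp
  have p1 : ∫ u in (0 : ℝ)..U, g u ≤ tailIntegral U + 2 * θ / 3 := by
    have hc : IntervalIntegrable (fun u : ℝ => Real.exp (-(u ^ 3 / 6))) volume 0 U :=
      Continuous.intervalIntegrable (by fun_prop) _ _
    calc ∫ u in (0 : ℝ)..U, g u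
        ≤ ∫ u in (0 : ℝ)..U, (Real.exp (-(u ^ 3 / 6)) + (2 * d + ((t ^ 3) ^ 2)⁻¹)) := by
          refine intervalIntegral.integral_mono_on hU0.le (hgi _ _) (hc.add (by simp))
            fun u hu => ?_
          have := hmain u hu.1 hu.2
          simp only [hg]
          linarith
      _ = tailIntegral U + U * (2 * d + ((t ^ 3) ^ 2)⁻¹) := by
          rw [intervalIntegral.integral_add hc (by simp)]
          simp [tailIntegral]
          ring
      _ ≤ _ := by
          have h1 : U * ((t ^ 3) ^ 2)⁻¹ ≤ θ / 3 := by
            have h2 : ((t ^ 3) ^ 2)⁻¹ ≤ t⁻¹ := by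
              refine inv_anti₀ ht0 ?_
              rw [← pow_mul]
              exact le_self_pow₀ ht1' (by norm_num)
            have h3 : U * t⁻¹ ≤ θ / 3 := by
              rw [← div_eq_mul_inv, div_le_iff₀ ht0]
              rw [div_le_iff₀ hθ] at ht1
              linarith
            exact (mul_le_mul_of_nonneg_left h2 hU0.le).trans h3
          linarith
  have p2 : ∫ u in U..t, g u ≤ 256 / U ^ 2 := by
    calc ∫ u in U..t, g u ≤ ∫ u in U..t, 512 / u ^ 3 := by
          refine intervalIntegral.integral_mono_on htU (hgi _ _) ?_ fun u hu => ?_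
          · refine ContinuousOn.intervalIntegrable fun u hu =>
              ContinuousAt.continuousWithinAt ?_
            rw [Set.uIcc_of_le htU] at hu
            exact continuousAt_const.div (by fun_prop) (pow_ne_zero 3 (by linarith [hu.1]))
          · have hu0 : 0 < u := by linarith [hu.1]
            exact htail u hu0 (pow_le_pow_left₀ hu0.le hu.2 3)
      _ = 512 / 2 * (1 / U ^ 2 - 1 / t ^ 2) := integral_div_cube hU0 htU _
      _ ≤ _ := by
          have : 0 ≤ 1 / t ^ 2 := by positivity
          have h2 : (256 : ℝ) / U ^ 2 = 256 * (1 / U ^ 2) := by ring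
          rw [h2]; linarith
  have htt : t ≤ 3 * t ^ 2 := by nlinarith
  have p3 : ∫ u in t..3 * t ^ 2, g u ≤ θ / 3 := by
    calc ∫ u in t..3 * t ^ 2, g u ≤ ∫ u in t..3 * t ^ 2, 512 / t ^ 3 := by
          refine intervalIntegral.integral_mono_on htt (hgi _ _) (by simp) fun u hu => ?_
          exact (hganti hu.1).trans (htail t ht0 le_rfl)
      _ = (3 * t ^ 2 - t) * (512 / t ^ 3) := by rw [intervalIntegral.integral_const, smul_eq_mul]
      _ ≤ (3 * t ^ 2) * (512 / t ^ 3) := by gcongr; linarith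
      _ = 1536 / t := by field_simp; ring
      _ ≤ θ / 3 := by
          rw [div_le_iff₀ ht0]
          rw [div_le_iff₀ hθ] at ht2
          linarith
  rw [hscale, mul_comm]
  refine mul_le_mul_of_nonneg_right ?_ hs0.le
  rw [← intervalIntegral.integral_add_adjacent_intervals (hgi 0 U) (hgi U _),
    ← intervalIntegral.integral_add_adjacent_intervals (hgi U t) (hgi t _)]
  linarith

/-- The event that all triples of row `i` cost at least `x`. -/
def rowGe (i : Fin n) (x : ℝ) : Set (CostIdx n → ℝ) := {v | ∀ j k, x ≤ costAt v i j k}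

theorem measurableSet_rowGe (i : Fin n) (x : ℝ) : MeasurableSet (rowGe i x) := by
  simpa [rowGe] using measurableSet_forall_le_costAt i Finset.univ Finset.univ x

theorem le_measure_rowGe (i : Fin n) {x : ℝ} (h0 : 0 ≤ x) (h1 : x < 1) :
    Real.exp (-((n : ℝ) ^ 2 * x ^ 3 / 6 / (1 - x))) ≤ (costLaw n).real (rowGe i x) := by
  have h := le_integral_avoidProb i Finset.univ Finset.univ h0 h1
  rw [← measureReal_avoid] at h
  simp only [Finset.mem_univ, true_implies, Finset.card_univ, Fintype.card_fin] at h
  refine le_trans (le_of_eq ?_) h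
  congr 3; ring

theorem measure_rowGe_anti (i : Fin n) : Antitone fun x => (costLaw n).real (rowGe i x) :=
  fun _ _ h => measureReal_mono (fun _ hv j k => h.trans (hv j k)) (measure_ne_top _ _)

theorem le_integral_rowGe_of_le (i : Fin n) {U : ℝ} {h : ℝ → ℝ} (hU : 0 ≤ U)
    (hU3 : U * (n : ℝ) ^ (-(2 / 3) : ℝ) ≤ 3) (hh : Continuous h)
    (hle : ∀ u, 0 ≤ u → u ≤ U →
      h u ≤ (costLaw n).real (rowGe i (u * (n : ℝ) ^ (-(2 / 3) : ℝ)))) :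
    (∫ u in (0 : ℝ)..U, h u) * (n : ℝ) ^ (-(2 / 3) : ℝ) ≤
      ∫ x in (0 : ℝ)..3, (costLaw n).real (rowGe i x) := by
  have hn : (0 : ℝ) < n := by exact_mod_cast (Nat.zero_le _).trans_lt i.2
  have hs0 : 0 < (n : ℝ) ^ (-(2 / 3) : ℝ) := Real.rpow_pos_of_pos hn _
  set s := (n : ℝ) ^ (-(2 / 3) : ℝ)
  have hanti := measure_rowGe_anti i
  have hgi : ∀ a b : ℝ, IntervalIntegrable (fun x => (costLaw n).real (rowGe i x)) volume a b :=
    fun a b => hanti.intervalIntegrable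
  have hg2 : Antitone fun u => (costLaw n).real (rowGe i (u * s)) := fun u w h =>
    hanti (by gcongr)
  have h1 := intervalIntegral.integral_comp_mul_right (a := 0) (b := U)
      (fun x => (costLaw n).real (rowGe i x)) hs0.ne'
  rw [zero_mul, smul_eq_mul] at h1
  have h2 : ∫ u in (0 : ℝ)..U, h u ≤ ∫ u in (0 : ℝ)..U, (costLaw n).real (rowGe i (u * s)) :=
    intervalIntegral.integral_mono_on hU (hh.intervalIntegrable _ _) hg2.intervalIntegrable
      fun u hu => hle u hu.1 hu.2
  rw [h1] at h2
  have h3 : 0 ≤ ∫ x in U * s..3, (costLaw n).real (rowGe i x) :=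
    intervalIntegral.integral_nonneg hU3 fun x _ => measureReal_nonneg
  rw [← intervalIntegral.integral_add_adjacent_intervals (hgi 0 (U * s)) (hgi (U * s) 3)]
  have h4 := mul_le_mul_of_nonneg_right h2 hs0.le
  rw [mul_comm s⁻¹, mul_assoc, inv_mul_cancel₀ hs0.ne', mul_one] at h4
  linarith

theorem sq_mul_cube_scale {n : ℕ} (hn : 0 < n) (u : ℝ) :
    (n : ℝ) ^ 2 * (u * (n : ℝ) ^ (-(2 / 3) : ℝ)) ^ 3 = u ^ 3 := by
  have ht0 : 0 < (n : ℝ) ^ (1 / 3 : ℝ) := Real.rpow_pos_of_pos (by exact_mod_cast hn) _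
  rw [rpow_neg_two_thirds]
  nth_rewrite 1 [← cubeRoot_pow_three n]
  field_simp

theorem one_eighth_mul_le_integral_rowGe (i : Fin n) :
    1 / 8 * (n : ℝ) ^ (-(2 / 3) : ℝ) ≤ ∫ x in (0 : ℝ)..3, (costLaw n).real (rowGe i x) := by
  have hn : 0 < n := (Nat.zero_le _).trans_lt i.2
  have hs0 : 0 < (n : ℝ) ^ (-(2 / 3) : ℝ) := Real.rpow_pos_of_pos (by exact_mod_cast hn) _
  have hs1 : (n : ℝ) ^ (-(2 / 3) : ℝ) ≤ 1 :=
    Real.rpow_le_one_of_one_le_of_nonpos (by exact_mod_cast hn) (by norm_num)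
  have h := le_integral_rowGe_of_le i (U := 1 / 2) (h := fun _ => 1 / 4) (by norm_num)
    (by linarith) continuous_const (fun u h0 h1 => ?_)
  · simp only [intervalIntegral.integral_const, smul_eq_mul] at h
    norm_num at h ⊢
    exact h
  · have hx1 : u * (n : ℝ) ^ (-(2 / 3) : ℝ) ≤ 1 / 2 := by nlinarith
    refine le_trans ?_ (le_measure_rowGe i (by positivity) (by linarith))
    rw [sq_mul_cube_scale hn]
    have h2 : u ^ 3 / 6 / (1 - u * (n : ℝ) ^ (-(2 / 3) : ℝ)) ≤ 3 / 4 := by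
      rw [div_le_iff₀ (by linarith)]
      have : u ^ 3 ≤ 1 := pow_le_one₀ h0 (by linarith)
      linarith
    linarith [Real.add_one_le_exp (-(u ^ 3 / 6 / (1 - u * (n : ℝ) ^ (-(2 / 3) : ℝ))))]

/-- The mean of a row minimum has the same leading constant as a round of greedy with `n` indices
left. -/
theorem le_integral_rowGe {U θ : ℝ} (hU : 1 ≤ U) (hθ : 0 < θ) :
    ∃ N : ℕ, ∀ n, N ≤ n → ∀ i : Fin n, (tailIntegral U - θ) * (n : ℝ) ^ (-(2 / 3) : ℝ) ≤
      ∫ x in (0 : ℝ)..3, (costLaw n).real (rowGe i x) := by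
  have hU0 : 0 < U := by linarith
  have hlim : Filter.Tendsto (fun n : ℕ => (n : ℝ) ^ (-(2 / 3) : ℝ)) Filter.atTop (nhds 0) :=
    (tendsto_rpow_neg_atTop (by norm_num)).comp tendsto_natCast_atTop_atTop
  have hev : ∀ᶠ n : ℕ in Filter.atTop, (n : ℝ) ^ (-(2 / 3) : ℝ) ≤ min (1 / (2 * U)) (θ / U ^ 5) :=
    hlim.eventually_le_const (lt_min (by positivity) (by positivity))
  obtain ⟨N, hN⟩ := Filter.eventually_atTop.1 hev
  refine ⟨N, fun n hn i => ?_⟩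
  have hn0 : 0 < n := (Nat.zero_le _).trans_lt i.2
  obtain ⟨hs1, hs2⟩ := le_min_iff.1 (hN n hn)
  rw [le_div_iff₀ (by positivity)] at hs1 hs2
  have hs0 : 0 < (n : ℝ) ^ (-(2 / 3) : ℝ) := Real.rpow_pos_of_pos (by exact_mod_cast hn0) _
  set s := (n : ℝ) ^ (-(2 / 3) : ℝ) with hs
  have hc : IntervalIntegrable (fun u : ℝ => Real.exp (-(u ^ 3 / 6))) volume 0 U :=
    Continuous.intervalIntegrable (by fun_prop) _ _
  have hUs : U * s ≤ 1 / 2 := by linarith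
  have h := le_integral_rowGe_of_le i (U := U)
    (h := fun u => Real.exp (-(u ^ 3 / 6)) - U ^ 4 * s) hU0.le (by linarith) (by fun_prop)
    (fun u h0 h1 => ?_)
  · rw [intervalIntegral.integral_sub hc (by simp)] at h
    simp only [intervalIntegral.integral_const, smul_eq_mul, sub_zero] at h
    refine le_trans (mul_le_mul_of_nonneg_right ?_ hs0.le) h
    unfold tailIntegral
    have : U * (U ^ 4 * s) = s * U ^ 5 := by ring
    linarith
  · have hus : u * s ≤ U * s := by gcongr
    have hx0 : 0 ≤ u * s := by positivity
    refine le_trans ?_ (le_measure_rowGe i hx0 (by linarith))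
    rw [sq_mul_cube_scale hn0]
    have hy : u ^ 3 ≤ U ^ 3 := pow_le_pow_left₀ h0 h1 3
    -- the relative error `1 / (1 - x) - 1` of the exponent is at most `2 * x`
    have h2 : u ^ 3 / 6 / (1 - u * s) ≤ u ^ 3 / 6 + U ^ 4 * s := by
      rw [div_le_iff₀ (by linarith)]
      have h3 : u ^ 3 * (u * s) ≤ U ^ 3 * (U * s) := by gcongr
      have h4 : (U ^ 4 * s) * (u * s) ≤ (U ^ 4 * s) * (1 / 2) := by gcongr; linarith
      have h5 : 0 ≤ U ^ 4 * s := by positivity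
      nlinarith
    have h3 : Real.exp (-(u ^ 3 / 6)) * Real.exp (-(U ^ 4 * s)) ≤
        Real.exp (-(u ^ 3 / 6 / (1 - u * s))) := by
      rw [← Real.exp_add]
      exact Real.exp_le_exp.2 (by linarith)
    refine le_trans ?_ h3
    have h4 := Real.add_one_le_exp (-(U ^ 4 * s))
    have h5 : Real.exp (-(u ^ 3 / 6)) ≤ 1 :=
      Real.exp_le_one_iff.2 (by have := pow_nonneg h0 3; linarith)
    have h6 : 0 ≤ U ^ 4 * s := by positivity
    nlinarith [mul_le_mul_of_nonneg_left h4 (Real.exp_pos (-(u ^ 3 / 6))).le,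
      mul_le_mul_of_nonneg_right h5 h6]

/-! ### The random model -/

theorem costAt_ae_mem_Icc : ∀ᵐ v ∂(costLaw n), ∀ i j k, 0 ≤ costAt v i j k ∧ costAt v i j k ≤ 3 := by
  have h : ∀ᵐ v ∂(costLaw n), ∀ s, 0 ≤ v s ∧ v s ≤ 1 := by
    rw [ae_all_iff]
    exact fun s => (measurePreserving_eval (fun _ => unifMeasure) s).quasiMeasurePreserving.ae
      unifMeasure_ae_mem_Icc
  filter_upwards [h] with v hv i j k
  obtain ⟨h1, h2⟩ := hv (aIdx i j)
  obtain ⟨h3, h4⟩ := hv (bIdx i k)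
  obtain ⟨h5, h6⟩ := hv (cIdx j k)
  unfold costAt
  exact ⟨by linarith, by linarith⟩

theorem measurable_costAt (i j k : Fin n) : Measurable fun v : CostIdx n → ℝ => costAt v i j k := by
  unfold costAt; fun_prop

theorem measurableSet_roundGe (i : Fin n) (x : ℝ) : MeasurableSet (roundGe i x) :=
  measurableSet_setOfPred.2 (Measurable.exists fun B => Measurable.exists fun C =>
    Measurable.exists fun T => (measurableSet_setOfPred.1 (measurableSet_greedyRun _ B C T)).and
      (measurableSet_setOfPred.1 (measurableSet_forall_le_costAt i B C x)))

section Model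

variable {Ω : Type u} [MeasurableSpace Ω] {μ : Measure Ω} [IsProbabilityMeasure μ]
  {a b c : Fin n → Fin n → Ω → ℝ}

/-- The whole family of costs as one random vector. -/
def costVector (a b c : Fin n → Fin n → Ω → ℝ) (ω : Ω) : CostIdx n → ℝ :=
  fun s => costFamily a b c s ω

theorem IsUniformModel.measurePreserving (h : IsUniformModel μ a b c) :
    MeasurePreserving (costVector a b c) μ (costLaw n) := by
  refine ⟨measurable_pi_iff.2 h.measurable, ?_⟩
  have h1 := (iIndepFun_iff_map_fun_eq_pi_map fun s => (h.measurable s).aemeasurable).1 h.indep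
  refine h1.trans ?_
  unfold costLaw
  congr 1
  funext s
  have := h.uniform s
  unfold pdf.IsUniform ProbabilityTheory.cond at this
  rw [this]
  simp

theorem IsUniformModel.randomCost_ae_mem_Icc (h : IsUniformModel μ a b c) :
    ∀ᵐ ω ∂μ, ∀ i j k, 0 ≤ randomCost a b c ω i j k ∧ randomCost a b c ω i j k ≤ 3 :=
  h.measurePreserving.quasiMeasurePreserving.ae costAt_ae_mem_Icc

theorem IsUniformModel.measurable_randomCost (h : IsUniformModel μ a b c) (i j k : Fin n) :
    Measurable fun ω => randomCost a b c ω i j k :=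
  (measurable_costAt i j k).comp h.measurePreserving.measurable

/-! ### Greedy assignments -/

section Assignment

variable {m : ℕ} {σ τ : Ω → Equiv.Perm (Fin n)}

theorem measurable_chosenCost (h : IsUniformModel μ a b c)
    (hg : IsRandomGreedySolution μ a b c m σ τ) (i : Fin n) :
    Measurable fun ω => randomCost a b c ω i (σ ω i) (τ ω i) := by
  have h1 : (fun ω => randomCost a b c ω i (σ ω i) (τ ω i)) = fun ω =>
      ∑ p : Equiv.Perm (Fin n), ∑ q : Equiv.Perm (Fin n), (σ ⁻¹' {p} ∩ τ ⁻¹' {q}).indicator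
        (fun ω => randomCost a b c ω i (p i) (q i)) ω := by
    funext ω
    rw [Finset.sum_eq_single (σ ω) (fun p _ hp => Finset.sum_eq_zero fun q _ =>
      Set.indicator_of_notMem (fun hq => hp hq.1.symm) _) (by simp),
      Finset.sum_eq_single (τ ω) (fun q _ hq' =>
      Set.indicator_of_notMem (fun hq => hq' hq.2.symm) _) (by simp),
      Set.indicator_of_mem (by exact ⟨rfl, rfl⟩)]
  rw [h1]
  exact Finset.measurable_sum _ fun p _ => Finset.measurable_sum _ fun q _ =>
    (h.measurable_randomCost _ _ _).indicator
      ((hg.measurable_left p).inter (hg.measurable_right q))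

theorem integrable_chosenCost (h : IsUniformModel μ a b c)
    (hg : IsRandomGreedySolution μ a b c m σ τ) (i : Fin n) :
    Integrable (fun ω => randomCost a b c ω i (σ ω i) (τ ω i)) μ := by
  refine Integrable.of_bound (measurable_chosenCost h hg i).aestronglyMeasurable 3 ?_
  filter_upwards [h.randomCost_ae_mem_Icc] with ω hω
  rw [Real.norm_eq_abs, abs_of_nonneg (hω _ _ _).1]
  exact (hω _ _ _).2

theorem integral_chosenCost_le_three (h : IsUniformModel μ a b c)
    (hg : IsRandomGreedySolution μ a b c m σ τ) (i : Fin n) :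
    ∫ ω, randomCost a b c ω i (σ ω i) (τ ω i) ∂μ ≤ 3 := by
  have h1 := integral_mono_ae (integrable_chosenCost h hg i) (integrable_const (3 : ℝ))
    (h.randomCost_ae_mem_Icc.mono fun ω hω => (hω _ _ _).2)
  simpa using h1

theorem integral_chosenCost_le (h : IsUniformModel μ a b c)
    (hg : IsRandomGreedySolution μ a b c m σ τ) (i : Fin n) (hi : (i : ℕ) < m) :
    ∫ ω, randomCost a b c ω i (σ ω i) (τ ω i) ∂μ ≤
      ∫ x in (0 : ℝ)..3, (costLaw n).real (roundGe i x) := by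
  rw [(integrable_chosenCost h hg i).integral_eq_integral_Ioc_meas_le
    (h.randomCost_ae_mem_Icc.mono fun ω hω => (hω _ _ _).1)
    (h.randomCost_ae_mem_Icc.mono fun ω hω => (hω _ _ _).2),
    ← intervalIntegral.integral_of_le (by norm_num)]
  refine intervalIntegral.integral_mono_on (by norm_num) (Antitone.intervalIntegrable
    fun x y hxy => measureReal_mono (fun ω hω => hxy.trans hω) (measure_ne_top _ _))
    (measure_roundGe_anti i).intervalIntegrable fun x _ => ?_
  rw [← h.measurePreserving.measureReal_preimage (measurableSet_roundGe i x).nullMeasurableSet]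
  refine ENNReal.toReal_mono (measure_ne_top _ _) (measure_mono_ae ?_)
  filter_upwards [hg.greedy] with ω hω hx
  obtain ⟨B, C, T, h1, h2⟩ := hω.le i hi
  exact ⟨B, C, T, h1, fun j hj k hk => le_trans hx (h2 j hj k hk)⟩

theorem integrable_assignmentCost (h : IsUniformModel μ a b c)
    (hg : IsRandomGreedySolution μ a b c m σ τ) :
    Integrable (fun ω => assignmentCost (randomCost a b c ω) (σ ω) (τ ω)) μ :=
  integrable_finsetSum _ fun i _ => integrable_chosenCost h hg i

theorem integral_assignmentCost (h : IsUniformModel μ a b c)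
    (hg : IsRandomGreedySolution μ a b c m σ τ) :
    ∫ ω, assignmentCost (randomCost a b c ω) (σ ω) (τ ω) ∂μ =
      ∑ i, ∫ ω, randomCost a b c ω i (σ ω i) (τ ω i) ∂μ :=
  integral_finsetSum _ fun i _ => integrable_chosenCost h hg i

end Assignment

/-! ### The optimal assignment -/

theorem integrable_optimalCost (h : IsUniformModel μ a b c) :
    Integrable (fun ω => optimalCost (randomCost a b c ω)) μ := by
  have hm : ∀ p : Equiv.Perm (Fin n) × Equiv.Perm (Fin n),
      Measurable fun ω => assignmentCost (randomCost a b c ω) p.1 p.2 := fun p =>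
    Finset.measurable_sum _ fun i _ => h.measurable_randomCost _ _ _
  have hmeas : Measurable fun ω => optimalCost (randomCost a b c ω) := by
    unfold optimalCost
    simp only [Finset.inf'_univ_eq_ciInf]
    exact Measurable.iInf hm
  refine Integrable.of_bound hmeas.aestronglyMeasurable (n * 3) ?_
  filter_upwards [h.randomCost_ae_mem_Icc] with ω hω
  have h0 : 0 ≤ optimalCost (randomCost a b c ω) :=
    Finset.le_inf' _ _ fun p _ => Finset.sum_nonneg fun i _ => (hω _ _ _).1
  rw [Real.norm_eq_abs, abs_of_nonneg h0]
  calc optimalCost (randomCost a b c ω) ≤ assignmentCost (randomCost a b c ω) 1 1 :=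
        Finset.inf'_le (fun p : Equiv.Perm (Fin n) × Equiv.Perm (Fin n) =>
          assignmentCost (randomCost a b c ω) p.1 p.2) (Finset.mem_univ (1, 1))
    _ ≤ ∑ _i : Fin n, (3 : ℝ) := Finset.sum_le_sum fun i _ => (hω _ _ _).2
    _ = n * 3 := by simp

/-- The optimal cost is at least the sum of the row minima. -/
theorem sum_integral_rowGe_le (h : IsUniformModel μ a b c) :
    ∑ i : Fin n, ∫ x in (0 : ℝ)..3, (costLaw n).real (rowGe i x) ≤
      ∫ ω, optimalCost (randomCost a b c ω) ∂μ := by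
  set Y : Fin n → Ω → ℝ := fun i ω => ⨅ p : Fin n × Fin n, randomCost a b c ω i p.1 p.2 with hY
  have hYm : ∀ i, Measurable (Y i) := fun i =>
    Measurable.iInf fun p => h.measurable_randomCost _ _ _
  have hYle : ∀ i ω j k, Y i ω ≤ randomCost a b c ω i j k := fun i ω j k =>
    ciInf_le (Set.finite_range _).bddBelow (j, k)
  have hY0 : ∀ᵐ ω ∂μ, ∀ i, 0 ≤ Y i ω ∧ Y i ω ≤ 3 := by
    filter_upwards [h.randomCost_ae_mem_Icc] with ω hω i
    exact ⟨Real.iInf_nonneg fun p => (hω _ _ _).1, (hYle i ω i i).trans (hω _ _ _).2⟩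
  have hYi : ∀ i, Integrable (Y i) μ := fun i => by
    refine Integrable.of_bound (hYm i).aestronglyMeasurable 3 ?_
    filter_upwards [hY0] with ω hω
    rw [Real.norm_eq_abs, abs_of_nonneg (hω i).1]
    exact (hω i).2
  have hE : ∀ i, ∫ ω, Y i ω ∂μ = ∫ x in (0 : ℝ)..3, (costLaw n).real (rowGe i x) := fun i => by
    rw [(hYi i).integral_eq_integral_Ioc_meas_le (hY0.mono fun ω hω => (hω i).1)
      (hY0.mono fun ω hω => (hω i).2), ← intervalIntegral.integral_of_le (by norm_num)]
    refine intervalIntegral.integral_congr fun x _ => ?_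
    rw [← h.measurePreserving.measureReal_preimage (measurableSet_rowGe i x).nullMeasurableSet]
    congr 1
    ext ω
    have : Nonempty (Fin n × Fin n) := ⟨(i, i)⟩
    change x ≤ Y i ω ↔ ∀ j k, x ≤ randomCost a b c ω i j k
    rw [hY, le_ciInf_iff (Set.finite_range _).bddBelow, Prod.forall]
  simp only [← hE]
  rw [← integral_finsetSum _ fun i _ => hYi i]
  refine integral_mono (integrable_finsetSum _ fun i _ => hYi i) (integrable_optimalCost h)
    fun ω => ?_
  exact Finset.le_inf' _ _ fun p _ => Finset.sum_le_sum fun i _ => hYle _ _ _ _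

end Model

/-! ### Summation over the rounds -/

theorem mul_rpow_neg_two_thirds {n : ℕ} (hn : 0 < n) :
    (n : ℝ) * (n : ℝ) ^ (-(2 / 3) : ℝ) = (n : ℝ) ^ (1 / 3 : ℝ) := by
  have h0 : (0 : ℝ) < n := by exact_mod_cast hn
  nth_rewrite 1 [← Real.rpow_one (n : ℝ)]
  rw [← Real.rpow_add h0]
  norm_num

/-- This is where the approximation ratio `3` comes from: round by round, greedy pays `m ^ (-2/3)`
with `m` decreasing from `n`, where the optimum pays `n ^ (-2/3)`. -/
theorem sum_rpow_neg_two_thirds_le (n : ℕ) :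
    ∑ m ∈ Finset.range n, ((m + 1 : ℕ) : ℝ) ^ (-(2 / 3) : ℝ) ≤ 3 * (n : ℝ) ^ (1 / 3 : ℝ) := by
  induction n with
  | zero => simp
  | succ n ih =>
    rw [Finset.sum_range_succ, rpow_neg_two_thirds]
    set s := (n : ℝ) ^ (1 / 3 : ℝ)
    set t := ((n + 1 : ℕ) : ℝ) ^ (1 / 3 : ℝ)
    have hs : s ^ 3 = n := cubeRoot_pow_three n
    have ht : t ^ 3 = n + 1 := by
      have := cubeRoot_pow_three (n + 1)
      push_cast at this ⊢
      simpa [t] using this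
    have hs0 : 0 ≤ s := Real.rpow_nonneg (Nat.cast_nonneg _) _
    have ht0 : 0 < t := Real.rpow_pos_of_pos (by positivity) _
    have hst : s ≤ t := Real.rpow_le_rpow (Nat.cast_nonneg _) (by simp) (by norm_num)
    have h1 : (t ^ 2)⁻¹ ≤ 3 * (t - s) := by
      rw [inv_le_iff_one_le_mul₀ (by positivity)]
      nlinarith [mul_nonneg (sub_nonneg.2 hst) (sub_nonneg.2 hst), mul_nonneg hs0 ht0.le,
        mul_nonneg (sub_nonneg.2 hst) (mul_nonneg (sub_nonneg.2 hst) hs0),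
        mul_nonneg (sub_nonneg.2 hst) (mul_nonneg (sub_nonneg.2 hst) ht0.le)]
    linarith

theorem lt_greedyRounds {n i : ℕ} (hi : i < greedyRounds n) :
    (n : ℝ) ^ (1 / 4 : ℝ) + 1 ≤ n - i := by
  have h1 : i + 1 ≤ ⌊(n : ℝ) - (n : ℝ) ^ (1 / 4 : ℝ)⌋₊ := hi
  have h2 := (Nat.le_floor_iff' (by omega)).1 h1
  push_cast at h2
  linarith

theorem sub_greedyRounds_le (n : ℕ) :
    (n : ℝ) - greedyRounds n ≤ (n : ℝ) ^ (1 / 4 : ℝ) + 1 := by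
  have := Nat.lt_floor_add_one ((n : ℝ) - (n : ℝ) ^ (1 / 4 : ℝ))
  unfold greedyRounds
  linarith

theorem fourthRoot_pow_four (n : ℕ) : ((n : ℝ) ^ (1 / 4 : ℝ)) ^ 4 = n := by
  rw [← Real.rpow_natCast, ← Real.rpow_mul (Nat.cast_nonneg n)]
  norm_num

/-- The number `n - greedyRounds n` of triples outside the control of greedy is negligible. -/
theorem exists_fourthRoot_le {θ : ℝ} (hθ : 0 < θ) :
    ∃ N : ℕ, ∀ n, N ≤ n → 3 * ((n : ℝ) ^ (1 / 4 : ℝ) + 1) ≤ θ * (n : ℝ) ^ (1 / 3 : ℝ) := by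
  have h1 : Filter.Tendsto (fun n : ℕ => (n : ℝ) ^ (1 / 12 : ℝ)) Filter.atTop Filter.atTop :=
    (tendsto_rpow_atTop (by norm_num)).comp tendsto_natCast_atTop_atTop
  obtain ⟨N, hN⟩ := Filter.eventually_atTop.1 (h1.eventually_ge_atTop (6 / θ))
  refine ⟨max N 1, fun n hn => ?_⟩
  have hn1 : (1 : ℝ) ≤ n := by exact_mod_cast (le_max_right _ _).trans hn
  have h2 := hN n ((le_max_left _ _).trans hn)
  have h3 : (n : ℝ) ^ (1 / 3 : ℝ) = (n : ℝ) ^ (1 / 12 : ℝ) * (n : ℝ) ^ (1 / 4 : ℝ) := by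
    rw [← Real.rpow_add (by linarith)]; norm_num
  have h4 : 1 ≤ (n : ℝ) ^ (1 / 4 : ℝ) := Real.one_le_rpow hn1 (by norm_num)
  rw [div_le_iff₀ hθ] at h2
  rw [h3]
  nlinarith

theorem integral_assignmentCost_le {U θ : ℝ} (hU : 1 ≤ U) (hθ : 0 < θ) :
    ∃ N : ℕ, ∀ n, N ≤ n → ∀ (Ω : Type u) [MeasurableSpace Ω] (μ : Measure Ω)
      [IsProbabilityMeasure μ] (a b c : Fin n → Fin n → Ω → ℝ), IsUniformModel μ a b c →
      ∀ σ τ : Ω → Equiv.Perm (Fin n), IsRandomGreedySolution μ a b c (greedyRounds n) σ τ →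
        ∫ ω, assignmentCost (randomCost a b c ω) (σ ω) (τ ω) ∂μ ≤
          3 * (tailIntegral U + 256 / U ^ 2 + θ) * (n : ℝ) ^ (1 / 3 : ℝ) := by
  obtain ⟨M, hM⟩ := integral_roundGe_le hU (half_pos hθ)
  obtain ⟨N, hN⟩ := exists_fourthRoot_le (half_pos hθ)
  refine ⟨max N (M ^ 4), fun n hn Ω _ μ _ a b c h σ τ hg => ?_⟩
  have hnN : N ≤ n := (le_max_left _ _).trans hn
  have hnM : M ^ 4 ≤ n := (le_max_right _ _).trans hn
  have hκ : 0 ≤ tailIntegral U := by linarith [half_le_tailIntegral hU]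
  set L : ℝ := tailIntegral U + 256 / U ^ 2 + θ / 2 with hL
  have hL0 : 0 ≤ L := by positivity
  set r : ℝ := (n : ℝ) ^ (1 / 4 : ℝ) with hr
  have hr0 : 0 ≤ r := Real.rpow_nonneg (Nat.cast_nonneg _) _
  have hr4 : r ^ 4 = n := fourthRoot_pow_four n
  have hround : ∀ i : Fin n, (i : ℕ) < greedyRounds n →
      ∫ ω, randomCost a b c ω i (σ ω i) (τ ω i) ∂μ ≤
        L * ((n - 1 - i + 1 : ℕ) : ℝ) ^ (-(2 / 3) : ℝ) := by
    intro i hi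
    have h1 := lt_greedyRounds hi
    set m := n - 1 - (i : ℕ) + 1 with hm
    have hmi : m + i = n := by omega
    have hmR : (m : ℝ) = n - i := by
      rw [eq_sub_iff_add_eq]; exact_mod_cast hmi
    have hrm : r ≤ m := by rw [hmR]; linarith
    have hm4 : n ≤ m ^ 4 := by
      have : (n : ℝ) ≤ (m : ℝ) ^ 4 := by
        rw [← hr4]; exact pow_le_pow_left₀ hr0 hrm 4
      exact_mod_cast this
    have hMm : M ≤ m := by
      by_contra hcon
      push Not at hcon
      have : m ^ 4 < M ^ 4 := Nat.pow_lt_pow_left hcon (by norm_num)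
      omega
    exact (integral_chosenCost_le h hg i hi).trans (hM m hMm n hm4 i hmi)
  have hpt : ∀ i : Fin n, ∫ ω, randomCost a b c ω i (σ ω i) (τ ω i) ∂μ ≤
      L * ((n - 1 - i + 1 : ℕ) : ℝ) ^ (-(2 / 3) : ℝ) +
        (if greedyRounds n ≤ (i : ℕ) then 3 else 0) := by
    intro i
    split_ifs with hi
    · have h1 := integral_chosenCost_le_three h hg i
      have : 0 ≤ L * ((n - 1 - i + 1 : ℕ) : ℝ) ^ (-(2 / 3) : ℝ) := by positivity
      linarith
    · simpa using hround i (not_le.1 hi)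
  rw [integral_assignmentCost h hg]
  refine (Finset.sum_le_sum fun i _ => hpt i).trans ?_
  rw [Finset.sum_add_distrib, ← Finset.mul_sum,
    Fin.sum_univ_eq_sum_range (fun i => ((n - 1 - i + 1 : ℕ) : ℝ) ^ (-(2 / 3) : ℝ)) n,
    Finset.sum_range_reflect (fun m => ((m + 1 : ℕ) : ℝ) ^ (-(2 / 3) : ℝ)) n,
    Fin.sum_univ_eq_sum_range (fun i => if greedyRounds n ≤ i then (3 : ℝ) else 0) n]
  have h1 := mul_le_mul_of_nonneg_left (sum_rpow_neg_two_thirds_le n) hL0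
  have h2 : ∑ i ∈ Finset.range n, (if greedyRounds n ≤ i then (3 : ℝ) else 0) ≤ 3 * (r + 1) := by
    rw [← Finset.sum_filter, Finset.sum_const, nsmul_eq_mul, mul_comm]
    have h3 : (Finset.range n).filter (fun i => greedyRounds n ≤ i) =
        Finset.Ico (greedyRounds n) n := by
      ext i; simp [and_comm]
    rw [h3, Nat.card_Ico]
    have h4 : ((n - greedyRounds n : ℕ) : ℝ) ≤ r + 1 := by
      rcases le_total (greedyRounds n) n with h5 | h5
      · rw [Nat.cast_sub h5]; exact sub_greedyRounds_le n
      · rw [Nat.sub_eq_zero_of_le h5]; push_cast; linarith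
    linarith
  have h3 := hN n hnN
  have h4 : 0 ≤ (n : ℝ) ^ (1 / 3 : ℝ) := Real.rpow_nonneg (Nat.cast_nonneg _) _
  nlinarith

theorem le_integral_optimalCost {U θ : ℝ} (hU : 1 ≤ U) (hθ : 0 < θ) :
    ∃ N : ℕ, ∀ n, N ≤ n → ∀ (Ω : Type u) [MeasurableSpace Ω] (μ : Measure Ω)
      [IsProbabilityMeasure μ] (a b c : Fin n → Fin n → Ω → ℝ), IsUniformModel μ a b c →
        (tailIntegral U - θ) * (n : ℝ) ^ (1 / 3 : ℝ) ≤
          ∫ ω, optimalCost (randomCost a b c ω) ∂μ := by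
  obtain ⟨N, hN⟩ := le_integral_rowGe hU hθ
  refine ⟨max N 1, fun n hn Ω _ μ _ a b c h => ?_⟩
  have hn0 : 0 < n := (le_max_right _ _).trans hn
  refine le_trans ?_ (sum_integral_rowGe_le h)
  refine le_trans (le_of_eq ?_) (Finset.sum_le_sum fun i _ => hN n ((le_max_left _ _).trans hn) i)
  rw [Finset.sum_const, Finset.card_univ, Fintype.card_fin, nsmul_eq_mul,
    ← mul_rpow_neg_two_thirds hn0]
  ring

end

theorem theorem1 :
    ∃ c₁ c₂ : ℝ, 0 < c₁ ∧ 0 < c₂ ∧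
      -- (a) and (b)
      (∀ n : ℕ, 1 ≤ n →
        ∀ (Ω : Type u) [MeasurableSpace Ω] (μ : Measure Ω) [IsProbabilityMeasure μ]
          (a b c : Fin n → Fin n → Ω → ℝ), IsUniformModel μ a b c →
          (Integrable (fun ω => optimalCost (randomCost a b c ω)) μ ∧
            c₁ * (n : ℝ) ^ (1 / 3 : ℝ) ≤ ∫ ω, optimalCost (randomCost a b c ω) ∂μ) ∧
          (∀ σ τ : Ω → Equiv.Perm (Fin n),
            IsRandomGreedySolution μ a b c (greedyRounds n) σ τ →
            Integrable (fun ω => assignmentCost (randomCost a b c ω) (σ ω) (τ ω)) μ ∧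
              ∫ ω, assignmentCost (randomCost a b c ω) (σ ω) (τ ω) ∂μ
                ≤ c₂ * (n : ℝ) ^ (1 / 3 : ℝ))) ∧
      -- greedy is a `(3 + o(1))`-approximation in expectation
      (∀ ε : ℝ, 0 < ε → ∃ N : ℕ, ∀ n : ℕ, N ≤ n →
        ∀ (Ω : Type u) [MeasurableSpace Ω] (μ : Measure Ω) [IsProbabilityMeasure μ]
          (a b c : Fin n → Fin n → Ω → ℝ), IsUniformModel μ a b c →
          ∀ σ τ : Ω → Equiv.Perm (Fin n),
            IsRandomGreedySolution μ a b c (greedyRounds n) σ τ →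
            ∫ ω, assignmentCost (randomCost a b c ω) (σ ω) (τ ω) ∂μ
              ≤ (3 + ε) * ∫ ω, optimalCost (randomCost a b c ω) ∂μ) := by
  obtain ⟨N₀, hN₀⟩ := integral_assignmentCost_le.{u} (U := 1) (θ := 1) le_rfl one_pos
  have hκ₁ := half_le_tailIntegral (le_refl (1 : ℝ))
  refine ⟨1 / 8, 3 * (tailIntegral 1 + 256 / 1 ^ 2 + 1) + 3 * N₀, by norm_num, by positivity,
    fun n hn Ω _ μ _ a b c h => ⟨⟨integrable_optimalCost h, ?_⟩, fun σ τ hg =>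
      ⟨integrable_assignmentCost h hg, ?_⟩⟩, fun ε hε => ?_⟩
  · refine le_trans ?_ (sum_integral_rowGe_le h)
    refine le_trans (le_of_eq ?_) (Finset.sum_le_sum fun i _ => one_eighth_mul_le_integral_rowGe i)
    rw [Finset.sum_const, Finset.card_univ, Fintype.card_fin, nsmul_eq_mul,
      ← mul_rpow_neg_two_thirds hn]
    ring
  · have hn1 : 1 ≤ (n : ℝ) ^ (1 / 3 : ℝ) :=
      Real.one_le_rpow (by exact_mod_cast hn) (by norm_num)
    rcases le_total N₀ n with hN | hN
    · refine (hN₀ n hN Ω μ a b c h σ τ hg).trans ?_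
      gcongr
      have : (0 : ℝ) ≤ N₀ := Nat.cast_nonneg _
      linarith
    · rw [integral_assignmentCost h hg]
      calc ∑ i, ∫ ω, randomCost a b c ω i (σ ω i) (τ ω i) ∂μ ≤ ∑ _i : Fin n, (3 : ℝ) :=
            Finset.sum_le_sum fun i _ => integral_chosenCost_le_three h hg i
        _ = 3 * n := by simp [mul_comm]
        _ ≤ 3 * N₀ * 1 := by
            rw [mul_one]
            gcongr
        _ ≤ _ := by
            gcongr
            linarith
  · -- `θ` is chosen so that `3 * (κ + 2 * θ) ≤ (3 + ε) * (κ - θ)` whenever `1 / 2 ≤ κ`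
    set θ := min (ε / (2 * (9 + ε))) 1 with hθ
    have hθ0 : 0 < θ := lt_min (by positivity) one_pos
    have hθε : θ * (2 * (9 + ε)) ≤ ε :=
      (le_div_iff₀ (by positivity)).1 (min_le_left _ _)
    set U := 256 / θ with hUdef
    have hU : 1 ≤ U := by
      rw [hUdef, le_div_iff₀ hθ0]
      linarith [min_le_right (ε / (2 * (9 + ε))) 1]
    have hUθ : 256 / U ^ 2 ≤ θ := by
      calc 256 / U ^ 2 ≤ 256 / U := by
            gcongr
            exact le_self_pow₀ hU (by norm_num)
        _ = θ := by rw [hUdef]; field_simp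
    have hκ := half_le_tailIntegral hU
    obtain ⟨N₁, hN₁⟩ := integral_assignmentCost_le.{u} hU hθ0
    obtain ⟨N₂, hN₂⟩ := le_integral_optimalCost.{u} hU hθ0
    refine ⟨max N₁ N₂, fun n hn Ω _ μ _ a b c h σ τ hg => ?_⟩
    have h1 := hN₁ n ((le_max_left _ _).trans hn) Ω μ a b c h σ τ hg
    have h2 := hN₂ n ((le_max_right _ _).trans hn) Ω μ a b c h
    have h3 : 0 ≤ (n : ℝ) ^ (1 / 3 : ℝ) := Real.rpow_nonneg (Nat.cast_nonneg _) _
    calc _ ≤ 3 * (tailIntegral U + 256 / U ^ 2 + θ) * (n : ℝ) ^ (1 / 3 : ℝ) := h1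
      _ ≤ (3 + ε) * (tailIntegral U - θ) * (n : ℝ) ^ (1 / 3 : ℝ) := by
          refine mul_le_mul_of_nonneg_right ?_ h3
          nlinarith
      _ ≤ (3 + ε) * ∫ ω, optimalCost (randomCost a b c ω) ∂μ := by
          rw [mul_assoc]
          gcongr
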